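/- Let $N_b<\infty$ be the number of orthonormal one-particle states, let $\mathcal F_\pm$ be the bosonic ($+$) or fermionic ($-$) Fock space over the one-particle space $\mathbb C^{N_b}$, with creation and annihilation operators $\hat a_i^\dagger,\hat a_i$ and number operator $\hat N$, and let $\mathcal F^0_\pm\subset\mathcal F_\pm$ be the dense subspace of vectors with finitely many particle-number components. Let $$\hat H=\sum_{n=0}^{n_{\max}}\ \sum_{i_1,\dots,i_n,\,j_1,\dots,j_n} h^{(n)}_{i_1\dots i_n,\,j_n\dots j_1}\,\hat a^\dagger_{i_1}\cdots\hat a^\dagger_{i_n}\hat a_{j_n}\cdots\hat a_{j_1}+\hat H^{\mathrm{nc}}$$ on $\mathcal F^0_\pm$, where $0<n_{\max}<\infty$, each $h^{(n)}$ is hermitian (as a matrix in the multi-indices $(i_1,\dots,i_n)$ and $(j_1,\dots,j_n)$), and $\hat H^{\mathrm{nc}}$ is a hermitian linear combination of strings of at most $2n_{\max}$ creation and annihilation operators that contain different numbers of creation and annihilation operators. For bosons assume in addition: * the highest-order interaction is positive definite: $\sum \bar u_{i_1\dots i_{n_{\max}}}h^{(n_{\max})}_{i_1\dots i_{n_{\max}},\,j_{n_{\max}}\dots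 j_1}u_{j_1\dots j_{n_{\max}}}>0$ for every nonzero permutation-symmetric $u$; * $\hat H^{\mathrm{nc}}$ does not spoil this: there are real $\theta<1$ and $C$ with $-\langle\Psi,\hat H^{\mathrm{nc}}\Psi\rangle\le\theta\langle\Psi,\hat H^{(n_{\max})}\Psi\rangle+C\|\Psi\|^2$ for all $\Psi\in\mathcal F^0_+$, where $\hat H^{(n_{\max})}$ is the $n=n_{\max}$ term of the sum above. For a hermitian $N_b\times N_b$ matrix $v$ (a non-local one-body potential) put $\hat H_v=\hat H+\sum_{ij}v_{ij}\hat a_i^\dagger\hat a_j$; if $\hat H_v$ is bounded from below on $\mathcal F^0_\pm$, denote its Friedrichs extension by the same symbol. Let $\beta>0$, let $Z[v]=\operatorname{Tr}e^{-\beta\hat H_v}$ (with $Z[v]=\infty$ if $\hat H_v$ is not bounded from below), and let $\mathcal V=\{v=v^\dagger : Z[v]<\infty\}$ be the set of admissible potentials. For $v\in\mathcal V$ let $\hat\rho_v=e^{-\beta\hat H_v}/Z[v]$ be the Gibbs state and let $(\gamma_v)_{ij}=\operatorname{Tr}\{\hat\rho_v\,\hat a_j^\dagger\hat a_i\}$ be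 its one-body reduced density matrix (1RDM), the traces being evaluated in the occupation number basis. Then for every $v\in\mathcal V$ the sums defining the entries of $\gamma_v$ converge absolutely, and the map $v\mapsto\gamma_v$ is injective on $\mathcal V$: the potential that generates a given equilibrium 1RDM is unique. -/

import Mathlib

open scoped InnerProductSpace ENNReal

noncomputable section

namespace RDMFT

/-- Bosons (upper sign `+`) or fermions (lower sign `-`). -/
inductive Statistics
  | boson
  | fermion

/-- The sign `±` attached to the exchange of two particles. -/
def Statistics.sign : Statistics → ℂ
  | .boson => 1
  | .fermion => -1

/-- Occupation numbers of `N` orthonormal one-particle states (`N` is the dimension of the one-particle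
space); a state holds at most one fermion and any number of bosons. -/
abbrev Occ (s : Statistics) (N : ℕ) : Type :=
  {n : Fin N → ℕ // s = Statistics.fermion → ∀ i, n i ≤ 1}

/-- The Fock space, in the occupation number representation. -/
abbrev Fock (s : Statistics) (N : ℕ) : Type := lp (fun _ : Occ s N => ℂ) 2

/-- The Fock vectors of finite length. As the one-particle space is finite-dimensional, these are the finite
linear combinations of the occupation number states. -/
abbrev PreFock (s : Statistics) (N : ℕ) : Type := Occ s N →₀ ℂ

/-- Operators from the space of Fock vectors of finite length to itself; multiplication is composition. -/
abbrev PreOp (s : Statistics) (N : ℕ) : Type := Module.End ℂ (PreFock s N)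

variable {s : Statistics} {N : ℕ}

open Classical in
/-- The normalised occupation number state `|n⟩` as a vector of the Fock space. -/
def ket (n : Occ s N) : Fock s N := lp.single 2 n (1 : ℂ)

/-- The inclusion of the vectors of finite length in the Fock space. -/
def toFock : PreFock s N →ₗ[ℂ] Fock s N := Finsupp.linearCombination ℂ ket

/-! ### Creation and annihilation operators

With `|n⟩` the normalised state `|i₁ … i_M⟩ / √(∏ n_i!)`, `i₁ ≤ … ≤ i_M`, these are the operators
`a†_i |i₁ … i_M⟩ = |i₁ … i_M i⟩` and their adjoints. Moving `i` to its ordered position in the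
list exchanges it with all particles in states `j > i`. -/

/-- The phase `(±1) ^ (number of particles in states j > i)`. -/
def phase (n : Occ s N) (i : Fin N) : ℂ := s.sign ^ (∑ j ∈ Finset.Ioi i, n.1 j)

/-- One particle less in state `i`. -/
def Occ.lower (n : Occ s N) (i : Fin N) : Occ s N :=
  ⟨Function.update n.1 i (n.1 i - 1), by
    intro hs j
    have hj := n.2 hs j
    by_cases h : j = i
    · subst h
      rw [Function.update_self]
      omega
    · rw [Function.update_of_ne h]
      exact hj⟩

/-- One particle more in state `i`; for fermions, the state `i` has to be empty. -/
def Occ.raise (n : Occ s N) (i : Fin N) (h : s = Statistics.fermion → n.1 i = 0) : Occ s N :=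
  ⟨Function.update n.1 i (n.1 i + 1), by
    intro hs j
    have hj := n.2 hs j
    have hi := h hs
    by_cases hji : j = i
    · subst hji
      rw [Function.update_self]
      omega
    · rw [Function.update_of_ne hji]
      exact hj⟩

/-- The annihilation operator `a_i`. (The factor `√(n_i)` vanishes if state `i` is empty.) -/
def anni (i : Fin N) : PreOp s N :=
  Finsupp.linearCombination ℂ fun n : Occ s N =>
    Finsupp.single (n.lower i) (phase n i * (Real.sqrt (n.1 i) : ℂ))

open Classical in
/-- The creation operator `a†_i`. -/
def crea (i : Fin N) : PreOp s N :=
  Finsupp.linearCombination ℂ fun n : Occ s N =>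
    if h : s = Statistics.fermion → n.1 i = 0 then
      Finsupp.single (n.raise i h) (phase n i * (Real.sqrt (n.1 i + 1) : ℂ))
    else 0

/-! ### Hamiltonians -/

/-- The operator is hermitian: `⟨H Φ, Ψ⟩ = ⟨Φ, H Ψ⟩` on the vectors of finite length. -/
def IsHermitianOp (H : PreOp s N) : Prop :=
  ∀ Φ Ψ : PreFock s N, ⟪toFock (H Φ), toFock Ψ⟫_ℂ = ⟪toFock Φ, toFock (H Ψ)⟫_ℂ

/-- The (real) expectation value `⟨Ψ, H Ψ⟩` of a hermitian operator. -/
def expect (H : PreOp s N) (Ψ : PreFock s N) : ℝ := (⟪toFock Ψ, toFock (H Ψ)⟫_ℂ).re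

/-- The number conserving `n`-body operator
`∑ h_{i₁…i_n, j_n…j₁} a†_{i₁} ⋯ a†_{i_n} a_{j_n} ⋯ a_{j₁}`. -/
def nBody (n : ℕ) (h : Matrix (Fin n → Fin N) (Fin n → Fin N) ℂ) : PreOp s N :=
  ∑ I : Fin n → Fin N, ∑ J : Fin n → Fin N,
    h I J • ((List.ofFn fun k => (crea (I k) : PreOp s N)).prod *
      (List.ofFn fun k => (anni (J k) : PreOp s N)).reverse.prod)

/-- A single creation (`inl i`) or annihilation (`inr i`) operator. -/
def ladder : Fin N ⊕ Fin N → PreOp s N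
  | .inl i => crea i
  | .inr i => anni i

/-- The span of the strings of at most `d` creation and annihilation operators that change the particle
number. -/
def nonConserving (s : Statistics) (N d : ℕ) : Submodule ℂ (PreOp s N) :=
  Submodule.span ℂ {A | ∃ l : List (Fin N ⊕ Fin N), l.length ≤ d ∧
    l.countP Sum.isLeft ≠ l.countP Sum.isRight ∧ A = (l.map ladder).prod}

/-- A Hamiltonian: a number conserving part with at most `nmax`-body interactions and a hermitian non-conserving
part, which contains at most `2 * nmax` creation and annihilation operators per term. For bosons the
highest-order interaction is positive definite, and the non-conserving part does not spoil this, that is,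
up to a constant its negative is bounded by a fraction `θ < 1` of the highest-order interaction. -/
structure Hamiltonian (s : Statistics) (N : ℕ) where
  nmax : ℕ
  nmax_pos : 0 < nmax
  h : (n : ℕ) → Matrix (Fin n → Fin N) (Fin n → Fin N) ℂ
  h_hermitian : ∀ n, (h n).IsHermitian
  nc : PreOp s N
  nc_mem : nc ∈ nonConserving s N (2 * nmax)
  nc_hermitian : IsHermitianOp nc
  /-- Only the permutation-symmetric `u` matter, as bosonic annihilation operators commute. -/
  posDef : s = Statistics.boson → ∀ u : (Fin nmax → Fin N) → ℂ, u ≠ 0 →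
    (∀ (σ : Equiv.Perm (Fin nmax)) (I : Fin nmax → Fin N), u (I ∘ σ) = u I) →
    0 < (∑ I, ∑ J, star (u I) * h nmax I J * u J).re
  nc_bound : s = Statistics.boson → ∃ θ C : ℝ, θ < 1 ∧ ∀ Ψ : PreFock s N,
    -expect nc Ψ ≤ θ * expect (nBody nmax (h nmax)) Ψ + C * ‖toFock Ψ‖ ^ 2

/-- The Hamiltonian as an operator on the vectors of finite length. -/
def Hamiltonian.op (H : Hamiltonian s N) : PreOp s N :=
  ∑ n ∈ Finset.range (H.nmax + 1), nBody n (H.h n) + H.nc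

/-- The non-local one-body potential `V_v = ∑ v_ij a†_i a_j`. -/
def potential (v : Matrix (Fin N) (Fin N) ℂ) : PreOp s N :=
  ∑ i, ∑ j, v i j • ((crea i : PreOp s N) * anni j)

/-- `H_v = H + V_v`. -/
def Hamiltonian.withPot (H : Hamiltonian s N) (v : Matrix (Fin N) (Fin N) ℂ) : PreOp s N :=
  H.op + potential v

/-! ### The self-adjoint realisation and the Gibbs state -/

/-- The operator is bounded from below. -/
def IsBoundedBelow (A : PreOp s N) : Prop :=
  ∃ c : ℝ, ∀ Ψ : PreFock s N, c * ‖toFock Ψ‖ ^ 2 ≤ expect A Ψ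

/-- The form domain of a hermitian operator that is bounded from below: the completion of the vectors of finite
length in the form norm. -/
def formDomain (A : PreOp s N) : Set (Fock s N) :=
  {ψ | ∃ u : ℕ → PreFock s N,
    Filter.Tendsto (fun k => toFock (u k)) Filter.atTop (nhds ψ) ∧
    Filter.Tendsto (fun p : ℕ × ℕ => expect A (u p.1 - u p.2)) Filter.atTop (nhds 0)}

/-- The Friedrichs extension of `A` (a hermitian operator bounded from below) maps `ψ` to `φ`: it is the restriction of
the adjoint of `A` to the form domain. -/
def FriedrichsMaps (A : PreOp s N) (ψ φ : Fock s N) : Prop :=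
  ψ ∈ formDomain A ∧ ∀ χ : PreFock s N, ⟪toFock χ, φ⟫_ℂ = ⟪toFock (A χ), ψ⟫_ℂ

/-- `T = exp (-β A)`, for the Friedrichs extension of `A`, with the exponential defined through the
eigendecomposition. This determines `T`. Every self-adjoint operator whose exponential has a finite trace has
an orthonormal basis of eigenvectors, so the exponentials with a finite trace are all covered. -/
structure IsBoltzmann (A : PreOp s N) (β : ℝ) (T : Fock s N →L[ℂ] Fock s N) : Prop where
  bounded_below : IsBoundedBelow A
  diagonal : ∃ (b : HilbertBasis (Occ s N) ℂ (Fock s N)) (E : Occ s N → ℝ),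
    (∀ k, FriedrichsMaps A (b k) ((E k : ℂ) • b k)) ∧
    ∀ k, T (b k) = (Real.exp (-β * E k) : ℂ) • b k

open Classical in
/-- `exp (-β A)`, if it is given by an eigendecomposition (and zero otherwise). -/
def boltzmann (A : PreOp s N) (β : ℝ) : Fock s N →L[ℂ] Fock s N :=
  if h : ∃ T, IsBoltzmann A β T then h.choose else 0

open Classical in
/-- The partition function `Z = Tr (exp (-β A))`, which is infinite if `A` is not bounded from below or
has no orthonormal basis of eigenvectors. -/
def partitionFunction (A : PreOp s N) (β : ℝ) : ℝ≥0∞ :=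
  if ∃ T, IsBoltzmann A β T then
    ∑' n : Occ s N, ENNReal.ofReal (⟪ket n, boltzmann A β (ket n)⟫_ℂ).re
  else ⊤

/-- The Gibbs state `exp (-β A) / Z`. -/
def gibbs (A : PreOp s N) (β : ℝ) : Fock s N →L[ℂ] Fock s N :=
  (((partitionFunction A β).toReal⁻¹ : ℝ) : ℂ) • boltzmann A β

/-- The diagonal matrix elements `⟨n| ρ a†_j a_i |n⟩`. -/
def rdmTerm (ρ : Fock s N →L[ℂ] Fock s N) (i j : Fin N) (n : Occ s N) : ℂ :=
  ⟪ket n, ρ (toFock ((crea j * anni i : PreOp s N) (Finsupp.single n 1)))⟫_ℂ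

/-- The one-body reduced density matrix `γ_ij = Tr (ρ a†_j a_i)`. -/
def rdm (ρ : Fock s N →L[ℂ] Fock s N) : Matrix (Fin N) (Fin N) ℂ :=
  Matrix.of fun i j => ∑' n : Occ s N, rdmTerm ρ i j n

/-- The hermitian matrices `v` with `Z[v] < ∞`. -/
def Hamiltonian.admissible (H : Hamiltonian s N) (β : ℝ) : Set (Matrix (Fin N) (Fin N) ℂ) :=
  {v | v.IsHermitian ∧ partitionFunction (H.withPot v) β < ⊤}

/-- The Gibbs state `ρ_v` of `H_v`. -/
def Hamiltonian.gibbsState (H : Hamiltonian s N) (β : ℝ) (v : Matrix (Fin N) (Fin N) ℂ) :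
    Fock s N →L[ℂ] Fock s N :=
  gibbs (H.withPot v) β

end RDMFT

end

noncomputable section

namespace RDMFT

open Filter Topology

variable {s : Statistics} {N : ℕ}

/-! ### Coordinates -/

/-! The proof is the Gibbs variational argument in the form of Klein's inequality. Let `v` and `v'`
be admissible with the same 1RDM, let `p_k`, `E_k`, `b_k` and `p'_l`, `E'_l`, `b'_l` be the Gibbs
weights, eigenvalues and eigenvectors of the two Hamiltonians, and put x = log p_k - log p'_l. The
relative entropy of the two Gibbs states is the sum of the nonnegative terms |⟨b'_l, b_k⟩|² p_k (x -
1 + e^{-x}), and it is at most β Tr ρ_v (V_v' - V_v) + log Z' - log Z (`klein_inequality`,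
`LoweredData.klein`). The trace depends on the state through the 1RDM alone, so exchanging `v` and
`v'` turns this bound into its negative. Both bounds are nonnegative, hence zero, and every term
vanishes: x = 0 whenever `b_k` and `b'_l` overlap. So the two Hamiltonians differ by a constant κ
(`EigenData.op_eq_add`); the vacuum gives κ = 0, and the one-particle states give v = v'
(`eq_zero_of_potential_eq_const`).

For bosons all operators are unbounded, and the work lies in making these traces finite. The central
fact is that an admissible Hamiltonian dominates the particle number in the form sense
(`Hamiltonian.dominatesNumber`). For fermions the particle number is bounded. For `nmax ≥ 2` the
positive definite top interaction grows faster in the particle number than all other number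
conserving terms. For `nmax = 1` the Hamiltonian is quadratic and the potential can destroy
positivity. There the finite trace is used: if the classical quadratic form were not positive
definite, coherent states along a ray would be a weakly null sequence of bounded energy, which a
spectrum tending to infinity excludes (`EigenData.not_weakly_null`, `quadForm_pos_of_eigenData`).

Domination lets `a_i` act on the form domain. With Jensen's inequality it also makes exp(-t H_v)
trace class for every t > 0 (`LoweredData.summable_exp`). Hence the mean particle number is finite,
and the 1RDM converges absolutely and can be computed in the eigenbasis
(`LoweredData.hasSum_rdmTerm`). -/

theorem inner_ket (n : Occ s N) (x : Fock s N) : ⟪ket n, x⟫_ℂ = x n := by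
  classical
  unfold ket
  rw [lp.inner_single_left]
  simp

theorem toFock_single (n : Occ s N) (c : ℂ) : toFock (Finsupp.single n c) = c • ket n := by
  simp [toFock]

theorem inner_toFock (Φ : PreFock s N) (x : Fock s N) :
    ⟪toFock Φ, x⟫_ℂ = Φ.sum fun n c => star c * x n := by
  simp only [toFock, Finsupp.linearCombination_apply, Finsupp.sum, sum_inner, inner_smul_left,
    inner_ket]
  rfl

theorem toFock_apply (Φ : PreFock s N) (n : Occ s N) : toFock Φ n = Φ n := by
  classical
  induction Φ using Finsupp.induction_linear with
  | zero => simp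
  | add f g hf hg => simp [hf, hg]
  | single m c =>
    rw [toFock_single, lp.coeFn_smul, Pi.smul_apply, ket, lp.single_apply]
    by_cases h : n = m
    · subst h; simp
    · simp [Finsupp.single_eq_of_ne h, h]

theorem inner_ket_toFock (n : Occ s N) (Φ : PreFock s N) : ⟪ket n, toFock Φ⟫_ℂ = Φ n := by
  rw [inner_ket, toFock_apply]

theorem toFock_injective : Function.Injective (toFock : PreFock s N → Fock s N) := by
  intro Φ Ψ h
  ext n
  rw [← toFock_apply, h, toFock_apply]

theorem hasSum_inner_toFock (Φ Ψ : PreFock s N) :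
    HasSum (fun n => star (Φ n) * Ψ n) ⟪toFock Φ, toFock Ψ⟫_ℂ := by
  have := lp.hasSum_inner (𝕜 := ℂ) (toFock Φ) (toFock Ψ)
  simpa [toFock_apply, mul_comm] using this

theorem hasSum_norm_sq (x : Fock s N) : HasSum (fun n => ‖x n‖ ^ 2) (‖x‖ ^ 2) := by
  have := Complex.hasSum_re (lp.hasSum_inner (𝕜 := ℂ) x x)
  simp only [inner_self_eq_norm_sq_to_K] at this
  convert this using 1
  · ext n; norm_cast
  · norm_cast

/-! ### Adjoint pairs -/

/-- `A` and `B` are formal adjoints of each other on the vectors of finite length. -/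
def Adj (A B : PreOp s N) : Prop :=
  ∀ Φ Ψ : PreFock s N, ⟪toFock (A Φ), toFock Ψ⟫_ℂ = ⟪toFock Φ, toFock (B Ψ)⟫_ℂ

theorem Adj.symm {A B : PreOp s N} (h : Adj A B) : Adj B A := by
  intro Φ Ψ
  rw [← inner_conj_symm, ← h, inner_conj_symm]

theorem Adj.one : Adj (1 : PreOp s N) 1 := fun _ _ => rfl

theorem Adj.mul {A B A' B' : PreOp s N} (h : Adj A B) (h' : Adj A' B') : Adj (A * A') (B' * B) := by
  intro Φ Ψ
  simp only [Module.End.mul_apply]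
  rw [h, h']

theorem Adj.add {A B A' B' : PreOp s N} (h : Adj A B) (h' : Adj A' B') : Adj (A + A') (B + B') := by
  intro Φ Ψ
  simp only [LinearMap.add_apply, map_add, inner_add_left, inner_add_right, h Φ Ψ, h' Φ Ψ]

theorem Adj.smul {A B : PreOp s N} (h : Adj A B) (c : ℂ) : Adj (c • A) (star c • B) := by
  intro Φ Ψ
  simp only [LinearMap.smul_apply, map_smul, inner_smul_left, inner_smul_right, h Φ Ψ]
  rfl

theorem Adj.sum {ι : Type*} (t : Finset ι) {A B : ι → PreOp s N} (h : ∀ i, Adj (A i) (B i)) :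
    Adj (∑ i ∈ t, A i) (∑ i ∈ t, B i) := by
  intro Φ Ψ
  simp only [LinearMap.sum_apply, map_sum, sum_inner, inner_sum, fun i => h i Φ Ψ]

theorem Adj.of_basis {A B : PreOp s N}
    (h : ∀ n m, star ((A (Finsupp.single n 1)) m) = (B (Finsupp.single m 1)) n) : Adj A B := by
  intro Φ Ψ
  induction Φ using Finsupp.induction_linear with
  | zero => simp
  | add f g hf hg => simp only [map_add, inner_add_left, hf, hg]
  | single n c =>
    induction Ψ using Finsupp.induction_linear with
    | zero => simp
    | add f g hf hg => simp only [map_add, inner_add_right, hf, hg]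
    | single m d =>
      have hA : A (Finsupp.single n c) = c • A (Finsupp.single n 1) := by
        rw [← map_smul]; simp
      have hB : B (Finsupp.single m d) = d • B (Finsupp.single m 1) := by
        rw [← map_smul]; simp
      rw [hA, hB]
      simp only [toFock_single, map_smul, inner_smul_left, inner_smul_right, inner_ket_toFock]
      rw [← inner_conj_symm, inner_ket_toFock, ← h]
      simp only [starRingEnd_apply]

theorem isHermitianOp_iff {A : PreOp s N} : IsHermitianOp A ↔ Adj A A := Iff.rfl

/-! ### Ladder operators on the occupation number states -/

theorem phase_sq (n : Occ s N) (i : Fin N) : phase n i * phase n i = 1 := by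
  unfold phase
  rw [← mul_pow]
  cases s <;> simp [Statistics.sign]

theorem star_phase (n : Occ s N) (i : Fin N) : star (phase n i) = phase n i := by
  unfold phase
  rw [star_pow]
  cases s <;> simp [Statistics.sign]

theorem phase_lower (n : Occ s N) (i : Fin N) : phase (n.lower i) i = phase n i := by
  unfold phase
  congr 1
  refine Finset.sum_congr rfl fun j hj => ?_
  have : j ≠ i := (Finset.mem_Ioi.1 hj).ne'
  simp [Occ.lower, this]

theorem anni_single (i : Fin N) (n : Occ s N) (c : ℂ) :
    anni i (Finsupp.single n c) =
      Finsupp.single (n.lower i) (c * (phase n i * (Real.sqrt (n.1 i) : ℂ))) := by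
  rw [anni, Finsupp.linearCombination_single, Finsupp.smul_single, smul_eq_mul]

theorem crea_single_of (i : Fin N) (n : Occ s N) (c : ℂ) (h : s = Statistics.fermion → n.1 i = 0) :
    crea i (Finsupp.single n c) =
      Finsupp.single (n.raise i h) (c * (phase n i * (Real.sqrt (n.1 i + 1) : ℂ))) := by
  simp only [crea, Finsupp.linearCombination_single]
  rw [dif_pos h, Finsupp.smul_single, smul_eq_mul]

theorem crea_single_of_not (i : Fin N) (n : Occ s N) (c : ℂ)
    (h : ¬ (s = Statistics.fermion → n.1 i = 0)) : crea i (Finsupp.single n c) = 0 := by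
  simp only [crea, Finsupp.linearCombination_single]
  rw [dif_neg h]
  simp

theorem lower_raise (n : Occ s N) (i : Fin N) (h) : (n.raise i h).lower i = n := by
  apply Subtype.ext
  simp [Occ.raise, Occ.lower]

theorem raise_lower (n : Occ s N) (i : Fin N) (hn : n.1 i ≠ 0)
    (h : s = Statistics.fermion → (n.lower i).1 i = 0) : (n.lower i).raise i h = n := by
  apply Subtype.ext
  have : n.1 i - 1 + 1 = n.1 i := by omega
  simp [Occ.raise, Occ.lower, this]

theorem lower_self_eq_zero (n : Occ s N) (i : Fin N) (h : s = Statistics.fermion) :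
    (n.lower i).1 i = 0 := by
  have := n.2 h i
  simp only [Occ.lower, Function.update_self]
  omega

theorem adj_anni (i : Fin N) : Adj (anni i : PreOp s N) (crea i) := by
  apply Adj.of_basis
  intro n m
  rw [anni_single]
  by_cases hm : s = Statistics.fermion → m.1 i = 0
  · rw [crea_single_of _ _ _ hm]
    by_cases hn : n.1 i = 0
    · have h1 : m.raise i hm ≠ n := by
        intro h
        rw [← h] at hn
        simp [Occ.raise] at hn
      simp [hn, Finsupp.single_eq_of_ne' h1]
    · by_cases h : n.lower i = m
      · subst h
        rw [raise_lower n i hn]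
        have : ((n.lower i).1 i : ℝ) + 1 = n.1 i := by
          have : (n.lower i).1 i + 1 = n.1 i := by simp [Occ.lower]; omega
          exact_mod_cast this
        rw [this, phase_lower]
        simp only [Finsupp.single_eq_same, star_mul', star_phase]
        simp
      · have h' : m.raise i hm ≠ n := by
          intro h'
          apply h
          rw [← h', lower_raise]
        rw [Finsupp.single_eq_of_ne' h, Finsupp.single_eq_of_ne' h', star_zero]
  · rw [crea_single_of_not _ _ _ hm]
    have : n.lower i ≠ m := by
      intro h
      apply hm
      intro hs
      rw [← h]
      exact lower_self_eq_zero n i hs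
    rw [Finsupp.single_eq_of_ne' this]
    simp

theorem adj_crea (i : Fin N) : Adj (crea i : PreOp s N) (anni i) := (adj_anni i).symm

theorem anni_apply (i : Fin N) (Ψ : PreFock s N) (m : Occ s N) :
    (anni i Ψ) m = ⟪toFock (crea i (Finsupp.single m 1)), toFock Ψ⟫_ℂ := by
  rw [adj_crea i, toFock_single, one_smul, inner_ket_toFock]

/-! ### The number operator -/

/-- The particle number. -/
def Occ.num (n : Occ s N) : ℕ := ∑ i, n.1 i

theorem num_lower (n : Occ s N) (i : Fin N) (hn : n.1 i ≠ 0) : (n.lower i).num = n.num - 1 := by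
  classical
  unfold Occ.num
  have h1 := Finset.add_sum_erase Finset.univ n.1 (Finset.mem_univ i)
  have h2 := Finset.add_sum_erase Finset.univ (n.lower i).1 (Finset.mem_univ i)
  have h3 : ∑ x ∈ Finset.univ.erase i, (n.lower i).1 x = ∑ x ∈ Finset.univ.erase i, n.1 x := by
    refine Finset.sum_congr rfl fun j hj => ?_
    simp [Occ.lower, Finset.ne_of_mem_erase hj]
  have h4 : (n.lower i).1 i = n.1 i - 1 := by simp [Occ.lower]
  omega

/-- Functions of the occupation numbers. -/
def diag (f : Occ s N → ℂ) : PreOp s N :=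
  Finsupp.linearCombination ℂ fun n => Finsupp.single n (f n)

theorem diag_single (f : Occ s N → ℂ) (n : Occ s N) (c : ℂ) :
    diag f (Finsupp.single n c) = Finsupp.single n (c * f n) := by
  simp [diag]

theorem diag_apply (f : Occ s N → ℂ) (Ψ : PreFock s N) (n : Occ s N) : diag f Ψ n = f n * Ψ n := by
  classical
  induction Ψ using Finsupp.induction_linear with
  | zero => simp
  | add g h hg hh => simp [hg, hh, mul_add]
  | single m c =>
    rw [diag_single]
    by_cases h : m = n
    · subst h; simp [mul_comm]
    · simp [Finsupp.single_eq_of_ne' h]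

/-- Annihilating a particle shifts the argument of `f`. The truncated subtraction is harmless, since
the factor `n.1 i` vanishes whenever state `i` is empty. -/
theorem crea_diag_anni (i : Fin N) (f : ℕ → ℂ) :
    (crea i : PreOp s N) * diag (fun n => f n.num) * anni i =
      diag fun n => (n.1 i : ℂ) * f (n.num - 1) := by
  refine Finsupp.lhom_ext fun n c => ?_
  simp only [Module.End.mul_apply, anni_single, diag_single]
  by_cases hn : n.1 i = 0
  · simp [hn]
  · have h := fun hs => lower_self_eq_zero n i hs
    rw [crea_single_of _ _ _ h, raise_lower n i hn, phase_lower, num_lower n i hn]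
    have h1 : ((n.lower i).1 i : ℝ) + 1 = n.1 i := by
      have : (n.lower i).1 i + 1 = n.1 i := by simp [Occ.lower]; omega
      exact_mod_cast this
    rw [h1]
    congr 1
    have h2 : (Real.sqrt (n.1 i) : ℂ) * (Real.sqrt (n.1 i) : ℂ) = n.1 i := by
      rw [← Complex.ofReal_mul, Real.mul_self_sqrt (by positivity)]; simp
    linear_combination c * f (n.num - 1) * ((Real.sqrt (n.1 i) : ℂ) * (Real.sqrt (n.1 i) : ℂ)) *
      phase_sq n i + c * f (n.num - 1) * h2

/-- The expectation value of a function of the particle number. -/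
def numExp (f : ℕ → ℝ) (Ψ : PreFock s N) : ℝ := Ψ.sum fun n c => f n.num * ‖c‖ ^ 2

theorem hasSum_numExp (f : ℕ → ℝ) (Ψ : PreFock s N) :
    HasSum (fun n => f n.num * ‖Ψ n‖ ^ 2) (numExp f Ψ) := by
  unfold numExp Finsupp.sum
  apply hasSum_sum_of_ne_finset_zero
  intro n hn
  simp [Finsupp.notMem_support_iff.1 hn]

theorem numExp_one (Ψ : PreFock s N) : numExp (fun _ => 1) Ψ = ‖toFock Ψ‖ ^ 2 := by
  have h1 := hasSum_numExp (fun _ => 1) Ψ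
  have h2 := hasSum_norm_sq (toFock Ψ)
  simp only [toFock_apply, one_mul] at h1 h2
  exact h1.unique h2

theorem numExp_mono {f g : ℕ → ℝ} (h : ∀ k, f k ≤ g k) (Ψ : PreFock s N) :
    numExp f Ψ ≤ numExp g Ψ :=
  hasSum_le (fun n => mul_le_mul_of_nonneg_right (h _) (by positivity)) (hasSum_numExp f Ψ)
    (hasSum_numExp g Ψ)

theorem numExp_nonneg {f : ℕ → ℝ} (h : ∀ k, 0 ≤ f k) (Ψ : PreFock s N) : 0 ≤ numExp f Ψ :=
  Finset.sum_nonneg fun _ _ => mul_nonneg (h _) (by positivity)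

theorem numExp_add (f g : ℕ → ℝ) (Ψ : PreFock s N) :
    numExp (fun k => f k + g k) Ψ = numExp f Ψ + numExp g Ψ := by
  simp [numExp, Finsupp.sum, add_mul, Finset.sum_add_distrib]

theorem numExp_mul (c : ℝ) (f : ℕ → ℝ) (Ψ : PreFock s N) :
    numExp (fun k => c * f k) Ψ = c * numExp f Ψ := by
  simp [numExp, Finsupp.sum, Finset.mul_sum, mul_assoc]

theorem numExp_sum {ι : Type*} (t : Finset ι) (f : ι → ℕ → ℝ) (Ψ : PreFock s N) :
    numExp (fun k => ∑ i ∈ t, f i k) Ψ = ∑ i ∈ t, numExp (f i) Ψ := by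
  simp only [numExp, Finsupp.sum, Finset.sum_mul]
  exact Finset.sum_comm

theorem inner_diag (f : ℕ → ℝ) (Ψ : PreFock s N) :
    ⟪toFock Ψ, toFock (diag (fun n => (f n.num : ℂ)) Ψ)⟫_ℂ = numExp f Ψ := by
  rw [inner_toFock, numExp, Finsupp.sum, Finsupp.sum]
  push_cast
  refine Finset.sum_congr rfl fun n _ => ?_
  rw [toFock_apply, diag_apply]
  have := Complex.conj_mul' (Ψ n)
  rw [starRingEnd_apply] at this
  linear_combination (f n.num : ℂ) * this

/-- Sum of `crea_diag_anni` over `i`, with ∑ n_i the particle number. Iterated, it produces falling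
factorials in `sum_norm_annis_sq`. -/
theorem sum_numExp_anni (f : ℕ → ℝ) (Ψ : PreFock s N) :
    ∑ i, numExp f (anni i Ψ) = numExp (fun k => k * f (k - 1)) Ψ := by
  have key : ∀ i, (numExp f (anni i Ψ) : ℂ) =
      ⟪toFock Ψ, toFock (diag (fun n => (n.1 i : ℂ) * (f (n.num - 1) : ℂ)) Ψ)⟫_ℂ := by
    intro i
    rw [← inner_diag, adj_anni i, ← crea_diag_anni i (fun k => (f k : ℂ))]
    rfl
  have : ((∑ i, numExp f (anni i Ψ) : ℝ) : ℂ) = (numExp (fun k => k * f (k - 1)) Ψ : ℝ) := by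
    push_cast
    simp only [key]
    rw [← inner_sum, ← map_sum, ← inner_diag]
    congr 2
    ext n
    simp only [Finsupp.coe_finsetSum, Finset.sum_apply, diag_apply]
    rw [← Finset.sum_mul, ← Finset.sum_mul]
    simp [Occ.num]
  exact_mod_cast this

theorem sum_norm_anni_sq (Ψ : PreFock s N) :
    ∑ i, ‖toFock (anni i Ψ)‖ ^ 2 = numExp (fun k => k) Ψ := by
  simp only [← numExp_one]
  rw [sum_numExp_anni]
  simp

theorem norm_anni_sq_le (i : Fin N) (Ψ : PreFock s N) :
    ‖toFock (anni i Ψ)‖ ^ 2 ≤ numExp (fun k => k) Ψ := by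
  rw [← sum_norm_anni_sq]
  exact Finset.single_le_sum (f := fun i => ‖toFock (anni i Ψ)‖ ^ 2) (fun _ _ => by positivity)
    (Finset.mem_univ i)

/-! ### Commutation relations of bosons -/

theorem commute_anni (i j : Fin N) : Commute (anni i : PreOp .boson N) (anni j) := by
  refine Finsupp.lhom_ext fun n c => ?_
  simp only [Module.End.mul_apply, anni_single]
  rcases eq_or_ne i j with rfl | hij
  · rfl
  · have h : (n.lower j).lower i = (n.lower i).lower j := by
      apply Subtype.ext
      simp only [Occ.lower, Function.update_of_ne hij, Function.update_of_ne hij.symm]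
      exact Function.update_comm hij.symm _ _ _
    have h1 : (n.lower j).1 i = n.1 i := by simp [Occ.lower, hij]
    have h2 : (n.lower i).1 j = n.1 j := by simp [Occ.lower, hij.symm]
    rw [h, h1, h2]
    congr 1
    simp only [phase, Statistics.sign, one_pow]
    ring

theorem anni_mul_crea (i j : Fin N) : (anni i : PreOp .boson N) * crea j =
    crea j * anni i + if i = j then 1 else 0 := by
  refine Finsupp.lhom_ext fun n c => ?_
  have hb : ∀ {P : Prop}, (Statistics.boson = Statistics.fermion → P) := fun h => by cases h
  simp only [Module.End.mul_apply, anni_single, LinearMap.add_apply, crea_single_of _ _ _ hb,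
    phase, Statistics.sign, one_pow, one_mul]
  rcases eq_or_ne i j with rfl | hij
  · rw [if_pos rfl, lower_raise]
    have h0 : (n.raise i hb).1 i = n.1 i + 1 := by simp [Occ.raise]
    rw [h0, Module.End.one_apply]
    have h2 : ∀ x : ℝ, 0 ≤ x → (Real.sqrt x : ℂ) * (Real.sqrt x : ℂ) = x := by
      intro x hx
      rw [← Complex.ofReal_mul, Real.mul_self_sqrt hx]
    have h3 := h2 (n.1 i + 1) (by positivity)
    have h4 := h2 (n.1 i) (by positivity)
    push_cast at h3 h4 ⊢
    by_cases hn : n.1 i = 0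
    · simp [hn]
    · rw [raise_lower n i hn, ← Finsupp.single_add]
      have h1 : ((n.lower i).1 i : ℝ) + 1 = n.1 i := by
        have : (n.lower i).1 i + 1 = n.1 i := by simp [Occ.lower]; omega
        exact_mod_cast this
      rw [h1]
      congr 1
      linear_combination c * h3 - c * h4
  · rw [if_neg hij, LinearMap.zero_apply, add_zero]
    have h : (n.raise j hb).lower i = (n.lower i).raise j hb := by
      apply Subtype.ext
      simp only [Occ.lower, Occ.raise, Function.update_of_ne hij, Function.update_of_ne hij.symm]
      exact Function.update_comm hij.symm _ _ _
    have h1 : (n.raise j hb).1 i = n.1 i := by simp [Occ.raise, hij]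
    have h2 : (n.lower i).1 j = n.1 j := by simp [Occ.lower, hij.symm]
    simp only [h, h1, h2]
    congr 1
    ring

/-! ### Expectation values -/

theorem expect_add (A B : PreOp s N) (Ψ : PreFock s N) :
    expect (A + B) Ψ = expect A Ψ + expect B Ψ := by
  simp [expect]

theorem expect_sum {ι : Type*} (t : Finset ι) (A : ι → PreOp s N) (Ψ : PreFock s N) :
    expect (∑ i ∈ t, A i) Ψ = ∑ i ∈ t, expect (A i) Ψ := by
  simp [expect, LinearMap.sum_apply]

theorem expect_shift (A : PreOp s N) (c : ℝ) (Ψ : PreFock s N) :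
    expect (A + (c : ℂ) • 1) Ψ = expect A Ψ + c * ‖toFock Ψ‖ ^ 2 := by
  rw [expect_add]
  congr 1
  simp only [expect, LinearMap.smul_apply, Module.End.one_apply, map_smul, inner_smul_right,
    inner_self_eq_norm_sq_to_K]
  norm_cast
  rw [Complex.re_ofReal_mul]
  rfl

theorem IsHermitianOp.shift {A : PreOp s N} (hA : IsHermitianOp A) (c : ℝ) :
    IsHermitianOp (A + (c : ℂ) • 1) := by
  have h := Adj.add (isHermitianOp_iff.1 hA) (Adj.one.smul (c : ℂ))
  rwa [show star (c : ℂ) = c from Complex.conj_ofReal c] at h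

theorem IsHermitianOp.inner_self {A : PreOp s N} (hA : IsHermitianOp A) (Ψ : PreFock s N) :
    ⟪toFock (A Ψ), toFock Ψ⟫_ℂ = expect A Ψ := by
  have h := inner_conj_symm (𝕜 := ℂ) (toFock (A Ψ)) (toFock Ψ)
  rw [← hA] at h
  rw [expect, ← hA]
  exact (Complex.conj_eq_iff_re.1 h).symm

/-- A hermitian operator with nonnegative expectation values. -/
structure IsNonnegOp (B : PreOp s N) : Prop where
  herm : IsHermitianOp B
  nonneg : ∀ Ψ, 0 ≤ expect B Ψ

/-- Cauchy–Schwarz for the form of `B`. A pre-inner product is all that is available, as `B` may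
have a kernel. -/
theorem IsNonnegOp.norm_inner_sq_le {B : PreOp s N} (hB : IsNonnegOp B) (Φ Ψ : PreFock s N) :
    ‖⟪toFock (B Φ), toFock Ψ⟫_ℂ‖ ^ 2 ≤ expect B Φ * expect B Ψ := by
  let core : PreInnerProductSpace.Core ℂ (PreFock s N) :=
    { inner := fun Φ Ψ => ⟪toFock (B Φ), toFock Ψ⟫_ℂ
      conj_inner_symm := fun x y => by
        change (starRingEnd ℂ) ⟪toFock (B y), toFock x⟫_ℂ = ⟪toFock (B x), toFock y⟫_ℂ
        rw [inner_conj_symm, hB.herm]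
      re_inner_nonneg := fun x => by
        rw [hB.herm]
        exact hB.nonneg x
      add_left := fun x y z => by
        change ⟪toFock (B (x + y)), toFock z⟫_ℂ = ⟪toFock (B x), toFock z⟫_ℂ + ⟪toFock (B y), toFock z⟫_ℂ
        simp
      smul_left := fun x y r => by
        change ⟪toFock (B (r • x)), toFock y⟫_ℂ = _ * ⟪toFock (B x), toFock y⟫_ℂ
        simp only [map_smul, inner_smul_left] }
  have h := @InnerProductSpace.Core.inner_mul_inner_self_le ℂ _ _ _ _ core Φ Ψ
  change ‖⟪toFock (B Φ), toFock Ψ⟫_ℂ‖ * ‖⟪toFock (B Ψ), toFock Φ⟫_ℂ‖ ≤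
    RCLike.re ⟪toFock (B Φ), toFock Φ⟫_ℂ * RCLike.re ⟪toFock (B Ψ), toFock Ψ⟫_ℂ at h
  rw [hB.herm Ψ Φ, norm_inner_symm (toFock Ψ), ← sq, hB.herm.inner_self, hB.herm.inner_self] at h
  exact h

theorem expect_add_vec_le {B : PreOp s N} (hB : ∀ Ψ, 0 ≤ expect B Ψ) (Φ Ψ : PreFock s N) :
    expect B (Φ + Ψ) ≤ 2 * expect B Φ + 2 * expect B Ψ := by
  have h := hB (Φ - Ψ)
  simp only [expect, map_add, map_sub, inner_add_left, inner_add_right, inner_sub_left,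
    inner_sub_right, Complex.add_re, Complex.sub_re] at h ⊢
  linarith

/-! ### Eigenvectors of the Friedrichs extension -/

/-- `b` is an eigenvector of the Friedrichs extension of `B` with eigenvalue `E`, approximated by `u` in
the form norm. -/
structure IsApprox (B : PreOp s N) (u : ℕ → PreFock s N) (b : Fock s N) (E : ℝ) : Prop where
  tendsto : Tendsto (fun k => toFock (u k)) atTop (𝓝 b)
  cauchy : Tendsto (fun p : ℕ × ℕ => expect B (u p.1 - u p.2)) atTop (𝓝 0)
  eigen : ∀ χ : PreFock s N, ⟪toFock (B χ), b⟫_ℂ = E * ⟪toFock χ, b⟫_ℂ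

theorem tendsto_norm_sub_sq {u : ℕ → PreFock s N} {b : Fock s N}
    (h : Tendsto (fun k => toFock (u k)) atTop (𝓝 b)) :
    Tendsto (fun p : ℕ × ℕ => ‖toFock (u p.1 - u p.2)‖ ^ 2) atTop (𝓝 0) := by
  have h1 : Tendsto (fun p : ℕ × ℕ => toFock (u p.1)) atTop (𝓝 b) := by
    rw [← prod_atTop_atTop_eq]; exact h.comp tendsto_fst
  have h2 : Tendsto (fun p : ℕ × ℕ => toFock (u p.2)) atTop (𝓝 b) := by
    rw [← prod_atTop_atTop_eq]; exact h.comp tendsto_snd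
  have := ((h1.sub h2).norm).pow 2
  simpa using this

/-- A shift changes the form by a multiple of the squared norm, and the approximating sequence is
Cauchy in norm already. -/
theorem FriedrichsMaps.exists_isApprox {A : PreOp s N} {b : Fock s N} {E : ℝ}
    (h : FriedrichsMaps A b ((E : ℂ) • b)) (c : ℝ) :
    ∃ u, IsApprox (A + (c : ℂ) • 1) u b (E + c) := by
  obtain ⟨⟨u, hu, hc⟩, he⟩ := h
  refine ⟨u, hu, ?_, fun χ => ?_⟩
  · simp only [expect_shift]
    simpa using hc.add ((tendsto_norm_sub_sq hu).const_mul c)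
  · simp only [LinearMap.add_apply, LinearMap.smul_apply, Module.End.one_apply, map_add, map_smul,
      inner_add_left, inner_smul_left, ← he, inner_smul_right, Complex.conj_ofReal]
    push_cast
    ring

theorem exists_forall_of_tendsto_prod {f : ℕ × ℕ → ℝ} (h : Tendsto f atTop (𝓝 0)) {ε : ℝ}
    (hε : 0 < ε) : ∃ m, ∀ i ≥ m, ∀ j ≥ m, f (i, j) < ε := by
  obtain ⟨⟨m1, m2⟩, hm⟩ := eventually_atTop.1 (h.eventually_lt_const hε)
  refine ⟨max m1 m2, fun i hi j hj => hm (i, j) ?_⟩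
  exact ⟨(le_max_left _ _).trans hi, (le_max_right _ _).trans hj⟩

theorem exists_bound_of_cauchy {B : PreOp s N} (hB : ∀ Ψ, 0 ≤ expect B Ψ) {u : ℕ → PreFock s N}
    (h : Tendsto (fun p : ℕ × ℕ => expect B (u p.1 - u p.2)) atTop (𝓝 0)) :
    ∃ K, 0 < K ∧ ∃ m, ∀ i ≥ m, expect B (u i) ≤ K := by
  obtain ⟨m, hm⟩ := exists_forall_of_tendsto_prod h one_pos
  refine ⟨2 + 2 * expect B (u m), by linarith [hB (u m)], m, fun i hi => ?_⟩
  have h1 := expect_add_vec_le hB (u i - u m) (u m)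
  have h2 := hm i hi m le_rfl
  rw [sub_add_cancel] at h1
  dsimp only at h2
  linarith

/-- Freezing `u i` and letting only the index of `w` grow gives E'⟨u i, b'⟩, by the eigenvalue
equation. Cauchy–Schwarz in the form makes the error uniform in `i`, because the energies of `u i`
are bounded. -/
theorem IsApprox.tendsto_inner {B : PreOp s N} (hB : IsNonnegOp B) {u w : ℕ → PreFock s N}
    {b b' : Fock s N} {E E' : ℝ} (h : IsApprox B u b E) (h' : IsApprox B w b' E') :
    Tendsto (fun i => ⟪toFock (B (u i)), toFock (w i)⟫_ℂ) atTop (𝓝 (E' * ⟪b, b'⟫_ℂ)) := by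
  have h1 : Tendsto (fun i => (E' : ℂ) * ⟪toFock (u i), b'⟫_ℂ) atTop (𝓝 (E' * ⟪b, b'⟫_ℂ)) :=
    (h.tendsto.inner tendsto_const_nhds).const_mul _
  obtain ⟨K, hK, m, hm⟩ := exists_bound_of_cauchy hB.nonneg h.cauchy
  have h2 : Tendsto (fun i => ⟪toFock (B (u i)), toFock (w i)⟫_ℂ - E' * ⟪toFock (u i), b'⟫_ℂ)
      atTop (𝓝 0) := by
    rw [Metric.tendsto_atTop]
    intro ε hε
    -- Cauchy–Schwarz bounds the squared error by `K` times this quantity, hence the error by ε/2.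
    obtain ⟨m', hm'⟩ := exists_forall_of_tendsto_prod h'.cauchy
      (show 0 < (ε / 2) ^ 2 / K by positivity)
    refine ⟨max m m', fun i hi => ?_⟩
    rw [dist_zero_right]
    have h3 : Tendsto (fun j => ‖⟪toFock (B (u i)), toFock (w i)⟫_ℂ -
        ⟪toFock (B (u i)), toFock (w j)⟫_ℂ‖) atTop
        (𝓝 ‖⟪toFock (B (u i)), toFock (w i)⟫_ℂ - E' * ⟪toFock (u i), b'⟫_ℂ‖) := by
      rw [← h'.eigen]
      exact (tendsto_const_nhds.sub (tendsto_const_nhds.inner h'.tendsto)).norm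
    have h4 : ‖⟪toFock (B (u i)), toFock (w i)⟫_ℂ - E' * ⟪toFock (u i), b'⟫_ℂ‖ ≤ ε / 2 := by
      refine le_of_tendsto h3 (eventually_atTop.2 ⟨m', fun j hj => ?_⟩)
      have h5 := hB.norm_inner_sq_le (u i) (w i - w j)
      rw [map_sub, inner_sub_right] at h5
      have h6 := hm i ((le_max_left _ _).trans hi)
      have h7 := hm' i ((le_max_right _ _).trans hi) j hj
      refine abs_le_of_sq_le_sq' ?_ (by positivity) |>.2
      refine h5.trans ((mul_le_mul h6 h7.le (hB.nonneg _) hK.le).trans ?_)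
      rw [mul_div_cancel₀ _ hK.ne']
    linarith
  simpa using h2.add h1

theorem IsApprox.tendsto_expect {B : PreOp s N} (hB : IsNonnegOp B) {u : ℕ → PreFock s N}
    {b : Fock s N} {E : ℝ} (h : IsApprox B u b E) (hb : ‖b‖ = 1) :
    Tendsto (fun i => expect B (u i)) atTop (𝓝 E) := by
  have h1 := (Complex.continuous_re.tendsto _).comp (h.tendsto_inner hB h)
  rw [inner_self_eq_norm_sq_to_K, hb] at h1
  simp only [Function.comp_def, hB.herm.inner_self, Complex.ofReal_re] at h1
  simpa using h1

theorem IsApprox.eigenvalue_nonneg {B : PreOp s N} (hB : IsNonnegOp B) {u : ℕ → PreFock s N}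
    {b : Fock s N} {E : ℝ} (h : IsApprox B u b E) (hb : ‖b‖ = 1) : 0 ≤ E :=
  ge_of_tendsto' (h.tendsto_expect hB hb) fun _ => hB.nonneg _

/-- Bessel's inequality in the form norm. -/
theorem sum_eigenvalue_le_expect {ι : Type*} {B : PreOp s N} (hB : IsNonnegOp B)
    {b : ι → Fock s N} (hb : Orthonormal ℂ b) {E : ι → ℝ} {w : ι → ℕ → PreFock s N}
    (h : ∀ l, IsApprox B (w l) (b l) (E l)) (F : Finset ι) (u : PreFock s N) :
    ∑ l ∈ F, E l * ‖⟪b l, toFock u⟫_ℂ‖ ^ 2 ≤ expect B u := by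
  classical
  set c : ι → ℂ := fun l => ⟪b l, toFock u⟫_ℂ with hc
  -- The form is nonnegative at `u` minus its projection on the eigenvectors. These need not have
  -- finite length, so their approximants are used and the limit is taken afterwards.
  have hx : ∀ i, 0 ≤ (⟪toFock (B u), toFock u⟫_ℂ - ∑ l ∈ F, c l * ⟪toFock (B u), toFock (w l i)⟫_ℂ -
      star (∑ l ∈ F, c l * ⟪toFock (B u), toFock (w l i)⟫_ℂ) +
      ∑ l ∈ F, ∑ k ∈ F, star (c l) * c k * ⟪toFock (B (w l i)), toFock (w k i)⟫_ℂ).re := by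
    intro i
    have h0 := hB.nonneg (u - ∑ l ∈ F, c l • w l i)
    rw [← Complex.ofReal_re (expect _ _), ← hB.herm.inner_self] at h0
    refine h0.trans_eq (congrArg Complex.re ?_)
    have h3 : ⟪toFock (B u), toFock (∑ l ∈ F, c l • w l i)⟫_ℂ =
        ∑ l ∈ F, c l * ⟪toFock (B u), toFock (w l i)⟫_ℂ := by
      simp only [map_sum, map_smul, inner_sum, inner_smul_right]
    have h4 : ⟪toFock (B (∑ l ∈ F, c l • w l i)), toFock u⟫_ℂ =
        star (∑ l ∈ F, c l * ⟪toFock (B u), toFock (w l i)⟫_ℂ) := by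
      rw [← h3, hB.herm, ← inner_conj_symm]; rfl
    have h5 : ⟪toFock (B (∑ l ∈ F, c l • w l i)), toFock (∑ l ∈ F, c l • w l i)⟫_ℂ =
        ∑ l ∈ F, ∑ k ∈ F, star (c l) * c k * ⟪toFock (B (w l i)), toFock (w k i)⟫_ℂ := by
      simp only [map_sum, map_smul, sum_inner, inner_sum, inner_smul_left, inner_smul_right,
        starRingEnd_apply, Finset.mul_sum]
      rw [Finset.sum_comm]
      exact Finset.sum_congr rfl fun l _ => Finset.sum_congr rfl fun k _ => by ring
    rw [map_sub, map_sub, map_sub, inner_sub_left, inner_sub_right, inner_sub_right, h3, h4, h5]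
    ring
  have hT : Tendsto (fun i => ⟪toFock (B u), toFock u⟫_ℂ -
      ∑ l ∈ F, c l * ⟪toFock (B u), toFock (w l i)⟫_ℂ -
      star (∑ l ∈ F, c l * ⟪toFock (B u), toFock (w l i)⟫_ℂ) +
      ∑ l ∈ F, ∑ k ∈ F, star (c l) * c k * ⟪toFock (B (w l i)), toFock (w k i)⟫_ℂ) atTop
      (𝓝 (⟪toFock (B u), toFock u⟫_ℂ - ∑ l ∈ F, c l * (E l * ⟪toFock u, b l⟫_ℂ) -
      star (∑ l ∈ F, c l * (E l * ⟪toFock u, b l⟫_ℂ)) +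
      ∑ l ∈ F, ∑ k ∈ F, star (c l) * c k * (E k * ⟪b l, b k⟫_ℂ))) := by
    have h1 : Tendsto (fun i => ∑ l ∈ F, c l * ⟪toFock (B u), toFock (w l i)⟫_ℂ) atTop
        (𝓝 (∑ l ∈ F, c l * (E l * ⟪toFock u, b l⟫_ℂ))) := by
      refine tendsto_finsetSum _ fun l _ => Tendsto.const_mul _ ?_
      rw [← (h l).eigen]
      exact tendsto_const_nhds.inner (h l).tendsto
    refine ((tendsto_const_nhds.sub h1).sub ((continuous_star.tendsto _).comp h1)).add ?_
    exact tendsto_finsetSum _ fun l _ => tendsto_finsetSum _ fun k _ =>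
      ((h l).tendsto_inner hB (h k)).const_mul _
  have hlim := ge_of_tendsto' ((Complex.continuous_re.tendsto _).comp hT) hx
  have h3 : ∀ l, c l * ((E l : ℂ) * ⟪toFock u, b l⟫_ℂ) = ((E l * ‖c l‖ ^ 2 : ℝ) : ℂ) := by
    intro l
    rw [← inner_conj_symm]
    have := Complex.mul_conj' (c l)
    push_cast
    rw [← this]
    simp only [hc]
    ring
  have h4 : ∀ l ∈ F, ∑ k ∈ F, star (c l) * c k * (E k * ⟪b l, b k⟫_ℂ) =
      ((E l * ‖c l‖ ^ 2 : ℝ) : ℂ) := by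
    intro l hl
    simp only [orthonormal_iff_ite.1 hb]
    rw [Finset.sum_eq_single l]
    · have := Complex.conj_mul' (c l)
      rw [starRingEnd_apply] at this
      push_cast
      rw [← this]
      simp
      ring
    · intro k _ hk
      simp [hk.symm]
    · exact fun h => absurd hl h
  rw [Finset.sum_congr rfl h4] at hlim
  simp only [h3, ← Complex.ofReal_sum] at hlim
  rw [show star ((∑ l ∈ F, E l * ‖c l‖ ^ 2 : ℝ) : ℂ) = _ from Complex.conj_ofReal _,
    hB.herm.inner_self] at hlim
  simp only [Complex.add_re, Complex.sub_re, Complex.ofReal_re] at hlim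
  linarith

/-! ### The eigendecomposition of the Gibbs state -/

/-- An orthonormal eigenbasis of the Friedrichs extension of `A` for which `exp (-β A)` has a finite
trace. -/
structure EigenData (A : PreOp s N) (β : ℝ) where
  b : HilbertBasis (Occ s N) ℂ (Fock s N)
  E : Occ s N → ℝ
  maps : ∀ k, FriedrichsMaps A (b k) ((E k : ℂ) • b k)
  summable : Summable fun k => Real.exp (-β * E k)
  bounded_below : IsBoundedBelow A

/-- The partition function. -/
def EigenData.Z {A : PreOp s N} {β : ℝ} (D : EigenData A β) : ℝ := ∑' k, Real.exp (-β * D.E k)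

/-- The occupation of an eigenstate. -/
def EigenData.p {A : PreOp s N} {β : ℝ} (D : EigenData A β) (k : Occ s N) : ℝ :=
  D.Z⁻¹ * Real.exp (-β * D.E k)

theorem HilbertBasis.hasSum_norm_inner_sq {ι 𝓗 : Type*} [NormedAddCommGroup 𝓗]
    [InnerProductSpace ℂ 𝓗] (b : HilbertBasis ι ℂ 𝓗) (x : 𝓗) :
    HasSum (fun i => ‖⟪b i, x⟫_ℂ‖ ^ 2) (‖x‖ ^ 2) := by
  have := Complex.hasSum_re (b.hasSum_inner_mul_inner x x)
  rw [inner_self_eq_norm_sq_to_K] at this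
  convert this using 1
  · ext i
    rw [← inner_conj_symm x, Complex.conj_mul']
    norm_cast
  · norm_cast

theorem hasSum_inner_of_diagonal {b : HilbertBasis (Occ s N) ℂ (Fock s N)}
    {T : Fock s N →L[ℂ] Fock s N} {t : Occ s N → ℝ} (h : ∀ k, T (b k) = (t k : ℂ) • b k)
    (x y : Fock s N) : HasSum (fun k => (t k : ℂ) * (⟪y, b k⟫_ℂ * ⟪b k, x⟫_ℂ)) ⟪y, T x⟫_ℂ := by
  have h1 := (b.hasSum_repr x).mapL T
  have h2 := h1.mapL (innerSL ℂ y)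
  have h3 : (fun k => (t k : ℂ) * (⟪y, b k⟫_ℂ * ⟪b k, x⟫_ℂ)) =
      fun k => innerSL ℂ y (T (b.repr x k • b k)) := by
    funext k
    simp only [map_smul, innerSL_apply_apply, h, b.repr_apply_apply, smul_eq_mul]
    ring
  rw [h3]
  exact h2

/-- Tonelli's theorem turns the trace over occupation states into the trace over the eigenbasis, so
a finite `partitionFunction` is summability of the Boltzmann factors. -/
theorem exists_eigenData {A : PreOp s N} {β : ℝ} (h : partitionFunction A β < ⊤) :
    ∃ D : EigenData A β, ∀ x y, HasSum (fun k => (D.p k : ℂ) * (⟪y, D.b k⟫_ℂ * ⟪D.b k, x⟫_ℂ))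
      ⟪y, gibbs A β x⟫_ℂ := by
  classical
  have hT : ∃ T, IsBoltzmann A β T := by
    by_contra hT
    rw [partitionFunction, if_neg hT] at h
    exact lt_irrefl _ h
  have hB : IsBoltzmann A β (boltzmann A β) := by
    rw [boltzmann, dif_pos hT]
    exact hT.choose_spec
  obtain ⟨b, E, hm, he⟩ := hB.diagonal
  have hs := hasSum_inner_of_diagonal he
  have hZ : partitionFunction A β = ∑' k, ENNReal.ofReal (Real.exp (-β * E k)) := by
    rw [partitionFunction, if_pos hT]
    have h1 : ∀ n, ENNReal.ofReal (⟪ket n, boltzmann A β (ket n)⟫_ℂ).re =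
        ∑' k, ENNReal.ofReal (Real.exp (-β * E k) * ‖b k n‖ ^ 2) := by
      intro n
      have h2 := Complex.hasSum_re (hs (ket n) (ket n))
      have h3 : ∀ k, ((Real.exp (-β * E k) : ℂ) * (⟪ket n, b k⟫_ℂ * ⟪b k, ket n⟫_ℂ)).re =
          Real.exp (-β * E k) * ‖b k n‖ ^ 2 := by
        intro k
        rw [← inner_conj_symm (b k), inner_ket, Complex.mul_conj']
        norm_cast
      simp only [h3] at h2
      rw [← h2.tsum_eq, ENNReal.ofReal_tsum_of_nonneg (fun _ => by positivity) h2.summable]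
    simp only [h1]
    rw [ENNReal.tsum_comm]
    refine tsum_congr fun k => ?_
    have h2 := (hasSum_norm_sq (b k)).mul_left (Real.exp (-β * E k))
    rw [b.orthonormal.1 k] at h2
    rw [← ENNReal.ofReal_tsum_of_nonneg (fun _ => by positivity) h2.summable, h2.tsum_eq]
    simp
  have hsum : Summable fun k => Real.exp (-β * E k) := by
    rw [hZ] at h
    have := ENNReal.summable_toReal h.ne
    simpa [ENNReal.toReal_ofReal (Real.exp_pos _).le] using this
  refine ⟨⟨b, E, hm, hsum, hB.bounded_below⟩, fun x y => ?_⟩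
  have hZ' : (partitionFunction A β).toReal = ∑' k, Real.exp (-β * E k) := by
    rw [hZ, ← ENNReal.ofReal_tsum_of_nonneg (fun _ => (Real.exp_pos _).le) hsum,
      ENNReal.toReal_ofReal (tsum_nonneg fun _ => (Real.exp_pos _).le)]
  have := (hs x y).mul_left (((∑' k, Real.exp (-β * E k))⁻¹ : ℝ) : ℂ)
  simp only [gibbs, hZ', _root_.smul_apply, inner_smul_right, EigenData.p, EigenData.Z]
  have h3 : ∀ k, (((∑' k, Real.exp (-β * E k))⁻¹ * Real.exp (-β * E k) : ℝ) : ℂ) *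
      (⟪y, b k⟫_ℂ * ⟪b k, x⟫_ℂ) = (((∑' k, Real.exp (-β * E k))⁻¹ : ℝ) : ℂ) *
        ((Real.exp (-β * E k) : ℂ) * (⟪y, b k⟫_ℂ * ⟪b k, x⟫_ℂ)) := by
    intro k
    push_cast
    ring
  simpa only [h3] using this

/-! ### `n`-body operators -/

/-- The product `a_{j_n} ⋯ a_{j_1}`. -/
def annis {n : ℕ} (J : Fin n → Fin N) : PreOp s N :=
  (List.ofFn fun k => (anni (J k) : PreOp s N)).reverse.prod

theorem adj_list (l : List (Fin N)) :
    Adj ((l.map anni).reverse.prod : PreOp s N) (l.map crea).prod := by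
  induction l with
  | nil => exact Adj.one
  | cons i l ih =>
    simp only [List.map_cons, List.reverse_cons, List.prod_append, List.prod_cons, List.prod_nil,
      mul_one]
    exact ih.mul (adj_anni i)

theorem adj_annis {n : ℕ} (J : Fin n → Fin N) :
    Adj (annis J : PreOp s N) (List.ofFn fun k => (crea (J k) : PreOp s N)).prod := by
  have h := adj_list (s := s) (List.ofFn J)
  rwa [List.map_ofFn, List.map_ofFn] at h

theorem inner_nBody (n : ℕ) (h : Matrix (Fin n → Fin N) (Fin n → Fin N) ℂ) (Φ Ψ : PreFock s N) :
    ⟪toFock Φ, toFock (nBody n h Ψ)⟫_ℂ =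
      ∑ I, ∑ J, h I J * ⟪toFock (annis I Φ), toFock (annis J Ψ)⟫_ℂ := by
  simp only [nBody, LinearMap.sum_apply, map_sum, inner_sum, LinearMap.smul_apply, map_smul,
    inner_smul_right, Module.End.mul_apply, adj_annis _ _ _]
  rfl

theorem inner_potential (v : Matrix (Fin N) (Fin N) ℂ) (Φ Ψ : PreFock s N) :
    ⟪toFock Φ, toFock (potential v Ψ)⟫_ℂ =
      ∑ i, ∑ j, v i j * ⟪toFock (anni i Φ), toFock (anni j Ψ)⟫_ℂ := by
  simp only [potential, LinearMap.sum_apply, map_sum, inner_sum, LinearMap.smul_apply, map_smul,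
    inner_smul_right, Module.End.mul_apply, adj_anni _ _ _]

theorem isHermitianOp_of_inner {ι : Type*} [Fintype ι] {A : PreOp s N} {h : Matrix ι ι ℂ}
    (hh : h.IsHermitian) {a : ι → PreOp s N}
    (H : ∀ Φ Ψ, ⟪toFock Φ, toFock (A Ψ)⟫_ℂ = ∑ I, ∑ J, h I J * ⟪toFock (a I Φ), toFock (a J Ψ)⟫_ℂ) :
    IsHermitianOp A := by
  intro Φ Ψ
  rw [H, ← inner_conj_symm, H, Finset.sum_comm]
  simp only [map_sum, map_mul, inner_conj_symm]
  refine Finset.sum_congr rfl fun I _ => Finset.sum_congr rfl fun J _ => ?_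
  rw [← hh.apply I J]
  rfl

theorem nBody_hermitian {n : ℕ} {h : Matrix (Fin n → Fin N) (Fin n → Fin N) ℂ}
    (hh : h.IsHermitian) : IsHermitianOp (nBody n h : PreOp s N) :=
  isHermitianOp_of_inner hh (inner_nBody n h)

theorem potential_hermitian {v : Matrix (Fin N) (Fin N) ℂ} (hv : v.IsHermitian) :
    IsHermitianOp (potential v : PreOp s N) :=
  isHermitianOp_of_inner hv (inner_potential v)

theorem Hamiltonian.withPot_hermitian (H : Hamiltonian s N) {v : Matrix (Fin N) (Fin N) ℂ}
    (hv : v.IsHermitian) : IsHermitianOp (H.withPot v) := by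
  have h1 : Adj (∑ n ∈ Finset.range (H.nmax + 1), nBody n (H.h n))
      (∑ n ∈ Finset.range (H.nmax + 1), (nBody n (H.h n) : PreOp s N)) :=
    Adj.sum _ fun n => nBody_hermitian (H.h_hermitian n)
  exact (h1.add H.nc_hermitian).add (potential_hermitian hv)

/-- Each inner product is at most half the sum of two squared norms, each of which is at most `M`.
-/
theorem abs_expect_le_of_inner {ι : Type*} [Fintype ι] {A : PreOp s N} {h : Matrix ι ι ℂ}
    {a : ι → PreOp s N} {Ψ : PreFock s N} {M : ℝ}
    (H : ⟪toFock Ψ, toFock (A Ψ)⟫_ℂ = ∑ I, ∑ J, h I J * ⟪toFock (a I Ψ), toFock (a J Ψ)⟫_ℂ)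
    (hM : ∑ I, ‖toFock (a I Ψ)‖ ^ 2 = M) :
    |expect A Ψ| ≤ (∑ I, ∑ J, ‖h I J‖) * M := by
  have h1 : ∀ I, ‖toFock (a I Ψ)‖ ^ 2 ≤ M := fun I => by
    rw [← hM]
    exact Finset.single_le_sum (f := fun I => ‖toFock (a I Ψ)‖ ^ 2) (fun _ _ => by positivity)
      (Finset.mem_univ I)
  refine (Complex.abs_re_le_norm _).trans ?_
  rw [H, Finset.sum_mul]
  refine norm_sum_le_of_le _ fun I _ => ?_
  rw [Finset.sum_mul]
  refine norm_sum_le_of_le _ fun J _ => ?_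
  rw [norm_mul]
  refine mul_le_mul_of_nonneg_left ?_ (norm_nonneg _)
  refine (norm_inner_le_norm _ _).trans ?_
  nlinarith [sq_nonneg (‖toFock (a I Ψ)‖ - ‖toFock (a J Ψ)‖), h1 I, h1 J]

theorem annis_cons {n : ℕ} (i : Fin N) (J : Fin n → Fin N) :
    (annis (Fin.cons i J : Fin (n + 1) → Fin N) : PreOp s N) = annis J * anni i := by
  simp [annis, List.ofFn_succ]

theorem sum_norm_annis_sq (n : ℕ) (Ψ : PreFock s N) :
    ∑ J : Fin n → Fin N, ‖toFock (annis J Ψ)‖ ^ 2 = numExp (fun k => (k.descFactorial n : ℝ)) Ψ := by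
  induction n generalizing Ψ with
  | zero => simp [annis, numExp_one]
  | succ n ih =>
    rw [← (Fin.consEquiv fun _ => Fin N).sum_comp, Fintype.sum_prod_type]
    have h1 : ∀ (i : Fin N) (J : Fin n → Fin N),
        annis ((Fin.consEquiv fun _ => Fin N) (i, J)) Ψ = annis J (anni i Ψ) := by
      intro i J
      have h2 : (Fin.consEquiv fun _ => Fin N) (i, J) = (Fin.cons i J : Fin (n + 1) → Fin N) := rfl
      rw [h2, annis_cons]
      rfl
    simp only [h1, ih, sum_numExp_anni]
    congr 1
    funext k
    cases k with
    | zero => simp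
    | succ k => rw [Nat.succ_descFactorial_succ]; simp

theorem abs_expect_nBody_le (n : ℕ) (h : Matrix (Fin n → Fin N) (Fin n → Fin N) ℂ)
    (Ψ : PreFock s N) : |expect (nBody n h) Ψ| ≤
      (∑ I, ∑ J, ‖h I J‖) * numExp (fun k => (k.descFactorial n : ℝ)) Ψ :=
  abs_expect_le_of_inner (inner_nBody n h Ψ Ψ) (sum_norm_annis_sq n Ψ)

theorem abs_expect_potential_le (v : Matrix (Fin N) (Fin N) ℂ) (Ψ : PreFock s N) :
    |expect (potential v) Ψ| ≤ (∑ i, ∑ j, ‖v i j‖) * numExp (fun k => (k : ℝ)) Ψ :=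
  abs_expect_le_of_inner (inner_potential v Ψ Ψ) (sum_norm_anni_sq Ψ)

/-! ### Domination of the particle number by the Hamiltonian -/

/-- The particle number is bounded in the form sense by the operator. -/
def DominatesNumber (A : PreOp s N) : Prop :=
  ∃ c > 0, ∃ C, ∀ Ψ : PreFock s N, c * numExp (fun k => (k : ℝ)) Ψ ≤ expect A Ψ + C * ‖toFock Ψ‖ ^ 2

theorem dominatesNumber_fermion {A : PreOp .fermion N} (hA : IsBoundedBelow A) :
    DominatesNumber A := by
  obtain ⟨c, hc⟩ := hA
  refine ⟨1, one_pos, N - c, fun Ψ => ?_⟩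
  have h1 : numExp (fun k => (k : ℝ)) Ψ ≤ N * ‖toFock Ψ‖ ^ 2 := by
    have h2 := (hasSum_norm_sq (toFock Ψ)).mul_left (N : ℝ)
    refine hasSum_le (fun n => ?_) (hasSum_numExp _ Ψ) h2
    rw [toFock_apply]
    refine mul_le_mul_of_nonneg_right ?_ (by positivity)
    have : n.num ≤ ∑ _i : Fin N, 1 := Finset.sum_le_sum fun i _ => n.2 rfl i
    simpa using this
  have := hc Ψ
  linarith

/-- By compactness `f` has a positive minimum on the part of the unit sphere in `S`; homogeneity
extends the bound to all of `S`. -/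
theorem exists_pos_mul_sum_sq_le {ι : Type*} [Fintype ι] {S : Set (ι → ℂ)} (hS : IsClosed S)
    (hsmul : ∀ u ∈ S, ∀ r : ℝ, (r : ℂ) • u ∈ S) {f : (ι → ℂ) → ℝ} (hf : Continuous f)
    (hom : ∀ (r : ℝ) u, f ((r : ℂ) • u) = r ^ 2 * f u) (hpos : ∀ u ∈ S, u ≠ 0 → 0 < f u) :
    ∃ c > 0, ∀ u ∈ S, c * ∑ i, ‖u i‖ ^ 2 ≤ f u := by
  have hK : IsCompact (Metric.sphere (0 : ι → ℂ) 1 ∩ S) := (isCompact_sphere _ _).inter_right hS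
  have h0 : f 0 = 0 := by simpa using hom 0 0
  have hm : ∃ m > 0, ∀ u ∈ Metric.sphere (0 : ι → ℂ) 1 ∩ S, m ≤ f u := by
    rcases (Metric.sphere (0 : ι → ℂ) 1 ∩ S).eq_empty_or_nonempty with h | h
    · exact ⟨1, one_pos, by simp [h]⟩
    · obtain ⟨u, hu, hmin⟩ := hK.exists_isMinOn h hf.continuousOn
      refine ⟨f u, hpos u hu.2 ?_, fun w hw => hmin hw⟩
      rintro rfl
      simpa using hu.1
  obtain ⟨m, hm0, hm⟩ := hm
  -- The norm of `ι → ℂ` is the maximum norm, so passing to the sum of squares costs the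
  -- cardinality; the `+ 1` covers empty `ι`.
  refine ⟨m / (Fintype.card ι + 1), by positivity, fun u hu => ?_⟩
  have h1 : ∑ i, ‖u i‖ ^ 2 ≤ Fintype.card ι * ‖u‖ ^ 2 := by
    have : ∑ i, ‖u i‖ ^ 2 ≤ ∑ _i : ι, ‖u‖ ^ 2 :=
      Finset.sum_le_sum fun i _ => pow_le_pow_left₀ (norm_nonneg _) (norm_le_pi_norm u i) 2
    simpa using this
  have h2 : m * ‖u‖ ^ 2 ≤ f u := by
    rcases eq_or_ne u 0 with rfl | hu0
    · simp [h0]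
    · have hn : ‖u‖ ≠ 0 := norm_ne_zero_iff.2 hu0
      have h3 := hm (((‖u‖⁻¹ : ℝ) : ℂ) • u) ⟨by simp [norm_smul, hn], hsmul u hu _⟩
      rw [hom] at h3
      have h4 : ‖u‖ ^ 2 * (‖u‖⁻¹ ^ 2 * f u) = f u := by field_simp
      nlinarith [sq_nonneg ‖u‖]
  refine le_trans ?_ h2
  rw [div_mul_eq_mul_div, div_le_iff₀ (by positivity)]
  nlinarith [mul_le_mul_of_nonneg_left h1 hm0.le, sq_nonneg ‖u‖]

theorem annis_comp_perm {n : ℕ} (J : Fin n → Fin N) (σ : Equiv.Perm (Fin n)) :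
    (annis (J ∘ σ) : PreOp .boson N) = annis J := by
  unfold annis
  refine List.Perm.prod_eq' ?_ ?_
  · refine (List.reverse_perm _).trans (List.Perm.trans ?_ (List.reverse_perm _).symm)
    exact Equiv.Perm.ofFn_comp_perm σ (fun k => (anni (J k) : PreOp .boson N))
  · rw [List.pairwise_reverse, List.pairwise_ofFn]
    exact fun i j _ => commute_anni _ _

/-- For a fixed occupation state `m`, the amplitudes of `annis I Ψ` at `m` are permutation symmetric
in `I`, because bosonic annihilation operators commute. The finite-dimensional bound therefore holds
for each `m`, and summing over `m` gives the operator bound. -/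
theorem nBody_lower_bound {n : ℕ} {h : Matrix (Fin n → Fin N) (Fin n → Fin N) ℂ}
    (hpos : ∀ u : (Fin n → Fin N) → ℂ, u ≠ 0 →
      (∀ (σ : Equiv.Perm (Fin n)) (I : Fin n → Fin N), u (I ∘ σ) = u I) →
      0 < (∑ I, ∑ J, star (u I) * h I J * u J).re) :
    ∃ c > 0, ∀ Ψ : PreFock .boson N,
      c * numExp (fun k => (k.descFactorial n : ℝ)) Ψ ≤ expect (nBody n h) Ψ := by
  obtain ⟨c, hc, hle⟩ := exists_pos_mul_sum_sq_le
    (S := {u : (Fin n → Fin N) → ℂ | ∀ (σ : Equiv.Perm (Fin n)) (I : Fin n → Fin N), u (I ∘ σ) = u I})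
    (f := fun u => (∑ I, ∑ J, star (u I) * h I J * u J).re)
    (by
      simp only [Set.ofPred_forall]
      exact isClosed_iInter fun σ => isClosed_iInter fun I =>
        isClosed_eq (continuous_apply _) (continuous_apply _))
    (fun u hu r σ I => by simp only [Pi.smul_apply, hu σ I])
    (by fun_prop)
    (fun r u => by
      have : ∀ I J, star (((r : ℂ) • u) I) * h I J * ((r : ℂ) • u) J =
          ((r ^ 2 : ℝ) : ℂ) * (star (u I) * h I J * u J) := by
        intro I J
        simp only [Pi.smul_apply, smul_eq_mul, star_mul',
          show star (r : ℂ) = r from Complex.conj_ofReal r]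
        push_cast
        ring
      simp only [this, ← Finset.mul_sum, Complex.re_ofReal_mul])
    (fun u hu hu0 => hpos u hu0 hu)
  refine ⟨c, hc, fun Ψ => ?_⟩
  have h1 : HasSum (fun m => c * ∑ I : Fin n → Fin N, ‖annis I Ψ m‖ ^ 2)
      (c * numExp (fun k => (k.descFactorial n : ℝ)) Ψ) := by
    rw [← sum_norm_annis_sq]
    refine HasSum.mul_left _ (hasSum_sum fun I _ => ?_)
    simpa [toFock_apply] using hasSum_norm_sq (toFock (annis I Ψ))
  have h2 : HasSum (fun m => (∑ I, ∑ J, star (annis I Ψ m) * h I J * annis J Ψ m).re)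
      (expect (nBody n h) Ψ) := by
    rw [expect, inner_nBody]
    refine Complex.hasSum_re (hasSum_sum fun I _ => hasSum_sum fun J _ => ?_)
    have := (hasSum_inner_toFock (annis I Ψ) (annis J Ψ)).mul_left (h I J)
    simpa only [mul_assoc, mul_left_comm] using this
  refine hasSum_le (fun m => hle (fun I => annis I Ψ m) fun σ I => ?_) h1 h2
  simp only [annis_comp_perm]

theorem descFactorial_le_descFactorial {k a b : ℕ} (hab : a ≤ b) (hb : b ≤ k) :
    k.descFactorial a ≤ k.descFactorial b := by
  induction b, hab using Nat.le_induction with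
  | base => rfl
  | succ b _ ih =>
    rw [Nat.descFactorial_succ]
    exact (ih (by omega)).trans (Nat.le_mul_of_pos_left _ (by omega))

theorem exists_forall_le_of_eventually {f : ℕ → ℝ} {m : ℕ} (h : ∀ k ≥ m, f k ≤ 0) :
    ∃ C, ∀ k, f k ≤ C := by
  refine ⟨∑ k ∈ Finset.range m, |f k|, fun k => ?_⟩
  rcases lt_or_ge k m with hk | hk
  · exact (le_abs_self _).trans (Finset.single_le_sum (f := fun k => |f k|)
      (fun _ _ => abs_nonneg _) (Finset.mem_range.2 hk))
  · exact (h k hk).trans (Finset.sum_nonneg fun _ _ => abs_nonneg _)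

/-- The falling factorial of order m is k - m + 1 times that of order m - 1, which bounds all lower
ones once k is large. The term linear in k counts among these because m ≥ 2. -/
theorem descFactorial_dominates {m : ℕ} (hm : 2 ≤ m) {c : ℝ} (hc : 0 < c) {L : ℝ} (hL : 0 ≤ L)
    {K : ℕ → ℝ} (hK : ∀ n, 0 ≤ K n) : ∃ C, ∀ k : ℕ,
      L * k + ∑ n ∈ Finset.range m, K n * (k.descFactorial n : ℝ) -
        c * (k.descFactorial m : ℝ) ≤ C := by
  obtain ⟨r, hr⟩ := exists_nat_ge ((L + ∑ n ∈ Finset.range m, K n) / c)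
  refine exists_forall_le_of_eventually (m := m + r) fun k hk => ?_
  obtain ⟨m, rfl⟩ : ∃ m', m = m' + 1 := ⟨m - 1, by omega⟩
  set d : ℝ := (k.descFactorial m : ℝ) with hd
  have h1 : L * k ≤ L * d := by
    refine mul_le_mul_of_nonneg_left ?_ hL
    have := descFactorial_le_descFactorial (k := k) (a := 1) (b := m) (by omega) (by omega)
    rw [Nat.descFactorial_one] at this
    rw [hd]
    exact_mod_cast this
  have h2 : ∑ n ∈ Finset.range (m + 1), K n * (k.descFactorial n : ℝ) ≤
      ∑ n ∈ Finset.range (m + 1), K n * d := by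
    refine Finset.sum_le_sum fun n hn => mul_le_mul_of_nonneg_left ?_ (hK n)
    have := descFactorial_le_descFactorial (k := k) (a := n) (b := m)
      (Nat.lt_succ_iff.1 (Finset.mem_range.1 hn)) (by omega)
    rw [hd]
    exact_mod_cast this
  have h3 : (r : ℝ) * d ≤ (k.descFactorial (m + 1) : ℝ) := by
    rw [Nat.descFactorial_succ]
    have : r * k.descFactorial m ≤ (k - m) * k.descFactorial m :=
      Nat.mul_le_mul_right _ (by omega)
    rw [hd]
    exact_mod_cast this
  rw [← Finset.sum_mul] at h2
  rw [div_le_iff₀ hc] at hr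
  have hd0 : 0 ≤ d := by positivity
  nlinarith [mul_le_mul_of_nonneg_right hr hd0, mul_le_mul_of_nonneg_left h3 hc.le]

/-- The non-conserving part uses up at most a fraction θ of the top interaction. The remaining
fraction 1 - θ absorbs the lower orders and the potential. -/
theorem dominatesNumber_of_two_le (H : Hamiltonian .boson N) (hn : 2 ≤ H.nmax)
    (v : Matrix (Fin N) (Fin N) ℂ) : DominatesNumber (H.withPot v) := by
  obtain ⟨c, hc, hle⟩ := nBody_lower_bound (H.posDef rfl)
  obtain ⟨θ, C, hθ, hnc⟩ := H.nc_bound rfl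
  -- The `+ 1` in `L` reserves one copy of the particle number for the conclusion.
  obtain ⟨C', hC'⟩ := descFactorial_dominates hn (mul_pos (sub_pos.2 hθ) hc)
    (L := (∑ i, ∑ j, ‖v i j‖) + 1) (by positivity) (K := fun n => ∑ I, ∑ J, ‖H.h n I J‖)
    (fun n => by positivity)
  refine ⟨1, one_pos, C + C', fun Ψ => ?_⟩
  have h1 := hle Ψ
  have h2 := hnc Ψ
  have h3 := (abs_le.1 (abs_expect_potential_le v Ψ)).1
  have h4 : ∀ n ∈ Finset.range H.nmax, -((∑ I, ∑ J, ‖H.h n I J‖) *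
      numExp (fun k => (k.descFactorial n : ℝ)) Ψ) ≤ expect (nBody n (H.h n)) Ψ :=
    fun n _ => (abs_le.1 (abs_expect_nBody_le n (H.h n) Ψ)).1
  have h5 := Finset.sum_le_sum h4
  rw [Finset.sum_neg_distrib] at h5
  have h6 : numExp (fun k : ℕ => ((∑ i, ∑ j, ‖v i j‖) + 1) * (k : ℝ) +
      ∑ n ∈ Finset.range H.nmax, (∑ I, ∑ J, ‖H.h n I J‖) * (k.descFactorial n : ℝ)) Ψ ≤
      numExp (fun k => (1 - θ) * c * (k.descFactorial H.nmax : ℝ) + C' * 1) Ψ :=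
    numExp_mono (fun k => by linarith [hC' k]) Ψ
  rw [numExp_add, numExp_add, numExp_mul, numExp_mul, numExp_mul, numExp_sum, numExp_one] at h6
  simp only [numExp_mul] at h6
  have h7 : expect (H.withPot v) Ψ = ∑ n ∈ Finset.range H.nmax, expect (nBody n (H.h n)) Ψ +
      expect (nBody H.nmax (H.h H.nmax)) Ψ + expect H.nc Ψ + expect (potential v) Ψ := by
    rw [Hamiltonian.withPot, Hamiltonian.op, expect_add, expect_add, expect_sum,
      Finset.sum_range_succ]
  have h8 := mul_le_mul_of_nonneg_left h1 (sub_pos.2 hθ).le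
  rw [h7]
  nlinarith

theorem inner_self_eq_ofReal (x : Fock s N) : ⟪x, x⟫_ℂ = ((‖x‖ ^ 2 : ℝ) : ℂ) := by
  rw [inner_self_eq_norm_sq_to_K]
  norm_cast

/-! ### Absence of weakly vanishing sequences of bounded energy -/

theorem EigenData.orthonormal {A : PreOp s N} {β : ℝ} (D : EigenData A β) : Orthonormal ℂ D.b :=
  D.b.orthonormal

theorem IsBoundedBelow.exists_nonneg {A : PreOp s N} (hA : IsHermitianOp A)
    (h : IsBoundedBelow A) : ∃ c : ℝ, IsNonnegOp (A + (c : ℂ) • 1) := by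
  obtain ⟨c, hc⟩ := h
  refine ⟨-c, hA.shift _, fun Ψ => ?_⟩
  rw [expect_shift]
  linarith [hc Ψ]

theorem tendsto_inner_zero_of_dense {φ : ℕ → PreFock s N} (hφ : ∀ t, ‖toFock (φ t)‖ = 1)
    (hw : ∀ χ, Tendsto (fun t => ⟪toFock χ, toFock (φ t)⟫_ℂ) atTop (𝓝 0))
    {u : ℕ → PreFock s N} {x : Fock s N} (hu : Tendsto (fun k => toFock (u k)) atTop (𝓝 x)) :
    Tendsto (fun t => ⟪x, toFock (φ t)⟫_ℂ) atTop (𝓝 0) := by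
  rw [Metric.tendsto_atTop]
  intro ε hε
  obtain ⟨k, hk⟩ := (Metric.tendsto_atTop.1 hu (ε / 2) (by positivity))
  obtain ⟨t0, ht0⟩ := Metric.tendsto_atTop.1 (hw (u k)) (ε / 2) (by positivity)
  refine ⟨t0, fun t ht => ?_⟩
  have h1 := hk k le_rfl
  have h2 := ht0 t ht
  rw [dist_zero_right] at h2 ⊢
  rw [dist_comm, dist_eq_norm] at h1
  have h3 : ⟪x, toFock (φ t)⟫_ℂ = ⟪x - toFock (u k), toFock (φ t)⟫_ℂ + ⟪toFock (u k), toFock (φ t)⟫_ℂ := by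
    rw [inner_sub_left]; ring
  have h4 := norm_inner_le_norm (𝕜 := ℂ) (x - toFock (u k)) (toFock (φ t))
  rw [hφ, mul_one] at h4
  rw [h3]
  refine (norm_add_le _ _).trans_lt ?_
  linarith

/-- A finite trace with β > 0 forces the eigenvalues to infinity. By Markov's inequality a unit
vector of bounded energy has at least half its weight on finitely many eigenvectors, and a weakly
null sequence loses its weight there. -/
theorem EigenData.not_weakly_null {A : PreOp s N} {β : ℝ} (hβ : 0 < β) (D : EigenData A β)
    (hA : IsHermitianOp A) {φ : ℕ → PreFock s N} (hφ : ∀ t, ‖toFock (φ t)‖ = 1) {K : ℝ}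
    (hK : ∀ t, expect A (φ t) ≤ K)
    (hw : ∀ χ, Tendsto (fun t => ⟪toFock χ, toFock (φ t)⟫_ℂ) atTop (𝓝 0)) : False := by
  classical
  obtain ⟨c, hB⟩ := D.bounded_below.exists_nonneg hA
  choose w hwap using fun k => (D.maps k).exists_isApprox c
  have hK' : ∀ t, expect (A + (c : ℂ) • 1) (φ t) ≤ K + c := by
    intro t
    rw [expect_shift, hφ]
    linarith [hK t]
  have hKc : 0 ≤ K + c := (hB.nonneg (φ 0)).trans (hK' 0)
  -- The `+ 1` makes `K'` positive, so that the cutoff 2K' leaves weight at most 1/2 above it.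
  set K' : ℝ := K + c + 1 with hK'def
  have hfin : {l | D.E l + c ≤ 2 * K'}.Finite := by
    have h1 := D.summable.tendsto_cofinite_zero.eventually_lt_const
      (Real.exp_pos (-β * (2 * K' - c)))
    refine (eventually_cofinite.1 h1).subset fun l hl => ?_
    simp only [Set.mem_ofPred_eq, not_lt, Real.exp_le_exp] at hl ⊢
    nlinarith
  set F0 := hfin.toFinset with hF0
  have h1 : ∀ t, (1 : ℝ) ≤ ∑ l ∈ F0, ‖⟪D.b l, toFock (φ t)⟫_ℂ‖ ^ 2 + 1 / 2 := by
    intro t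
    have h2 := HilbertBasis.hasSum_norm_inner_sq D.b (toFock (φ t))
    rw [hφ, one_pow] at h2
    refine hasSum_le_of_sum_le h2 fun F => ?_
    have h3 := sum_eigenvalue_le_expect hB D.orthonormal hwap (F \ F0) (φ t)
    have h4 : ∑ l ∈ F \ F0, 2 * K' * ‖⟪D.b l, toFock (φ t)⟫_ℂ‖ ^ 2 ≤
        ∑ l ∈ F \ F0, (D.E l + c) * ‖⟪D.b l, toFock (φ t)⟫_ℂ‖ ^ 2 := by
      refine Finset.sum_le_sum fun l hl => mul_le_mul_of_nonneg_right ?_ (by positivity)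
      have := (Finset.mem_sdiff.1 hl).2
      rw [hF0, Set.Finite.mem_toFinset, Set.mem_ofPred_eq, not_le] at this
      exact this.le
    rw [← Finset.mul_sum] at h4
    have h5 : ∑ l ∈ F \ F0, ‖⟪D.b l, toFock (φ t)⟫_ℂ‖ ^ 2 ≤ 1 / 2 := by
      have := hK' t
      by_contra! h6
      nlinarith
    have h6 : ∑ l ∈ F, ‖⟪D.b l, toFock (φ t)⟫_ℂ‖ ^ 2 ≤
        ∑ l ∈ F0 ∪ F \ F0, ‖⟪D.b l, toFock (φ t)⟫_ℂ‖ ^ 2 := by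
      refine Finset.sum_le_sum_of_subset_of_nonneg ?_ fun _ _ _ => by positivity
      rw [Finset.union_sdiff_self_eq_union]
      exact Finset.subset_union_right
    rw [Finset.sum_union Finset.disjoint_sdiff] at h6
    linarith
  have h2 : Tendsto (fun t => ∑ l ∈ F0, ‖⟪D.b l, toFock (φ t)⟫_ℂ‖ ^ 2 + 1 / 2) atTop
      (𝓝 (∑ l ∈ F0, ‖(0 : ℂ)‖ ^ 2 + 1 / 2)) :=
    (tendsto_finsetSum _ fun l _ =>
      ((tendsto_inner_zero_of_dense hφ hw (hwap l).tendsto).norm.pow 2)).add_const _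
  have h3 := ge_of_tendsto' h2 h1
  norm_num at h3

/-! ### Sums of products over occupation numbers -/

/-- Enlarging `F` to a box makes the sum factorise. -/
theorem sum_prod_le {ι : Type*} [Fintype ι] {f : ι → ℕ → ℝ} (hf : ∀ i k, 0 ≤ f i k)
    {B : ι → ℝ} (hB : ∀ i (F : Finset ℕ), ∑ k ∈ F, f i k ≤ B i) (F : Finset (ι → ℕ)) :
    ∑ n ∈ F, ∏ i, f i (n i) ≤ ∏ i, B i := by
  classical
  have h1 : F ⊆ Fintype.piFinset fun i => F.image fun n => n i := fun n hn =>
    Fintype.mem_piFinset.2 fun i => Finset.mem_image_of_mem _ hn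
  refine (Finset.sum_le_sum_of_subset_of_nonneg h1 fun _ _ _ =>
    Finset.prod_nonneg fun i _ => hf i _).trans ?_
  rw [← Finset.prod_univ_sum]
  exact Finset.prod_le_prod (fun i _ => Finset.sum_nonneg fun k _ => hf i k) fun i _ => hB i _

/-! ### Truncated coherent states -/

/-- The coefficient of a coherent state. -/
def cohCoeff (z : Fin N → ℂ) (n : Occ .boson N) : ℂ := ∏ i, z i ^ n.1 i / (Real.sqrt ((n.1 i).factorial) : ℂ)

theorem finite_num_le (M : ℕ) : {n : Occ .boson N | n.num ≤ M}.Finite := by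
  refine ((Set.finite_Icc (0 : Fin N → ℕ) fun _ => M).preimage
    (Subtype.val_injective.injOn)).subset fun n hn => ?_
  refine ⟨fun i => Nat.zero_le _, fun i => ?_⟩
  exact (Finset.single_le_sum (f := n.1) (fun _ _ => Nat.zero_le _) (Finset.mem_univ i)).trans hn

/-- The unnormalised coherent state, truncated at `M` particles. -/
def coh (M : ℕ) (z : Fin N → ℂ) : PreFock .boson N :=
  Finsupp.ofSupportFinite (fun n => if n.num ≤ M then cohCoeff z n else 0)
    ((finite_num_le M).subset fun n hn => by
      by_contra h
      exact hn (if_neg h))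

theorem coh_apply (M : ℕ) (z : Fin N → ℂ) (n : Occ .boson N) :
    coh M z n = if n.num ≤ M then cohCoeff z n else 0 := rfl

/-- A coherent state is an eigenvector of `anni i`; truncated, it is so up to a drop of the cutoff
by one. -/
theorem anni_coh (M : ℕ) (z : Fin N → ℂ) (i : Fin N) : anni i (coh (M + 1) z) = z i • coh M z := by
  ext m
  have hb : Statistics.boson = Statistics.fermion → m.1 i = 0 := fun h => by cases h
  have h1 : (m.raise i hb).num = m.num + 1 := by
    have h := num_lower (m.raise i hb) i (by simp [Occ.raise])
    rw [lower_raise] at h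
    have h2 : 1 ≤ (m.raise i hb).num := by
      refine le_trans ?_ (Finset.single_le_sum (f := (m.raise i hb).1) (fun _ _ => Nat.zero_le _)
        (Finset.mem_univ i))
      simp [Occ.raise]
    omega
  have h2 : cohCoeff z (m.raise i hb) * (Real.sqrt (m.1 i + 1) : ℂ) = z i * cohCoeff z m := by
    unfold cohCoeff
    rw [← Finset.mul_prod_erase _ _ (Finset.mem_univ i),
      ← Finset.mul_prod_erase Finset.univ (fun i => z i ^ m.1 i / (Real.sqrt ((m.1 i).factorial) : ℂ))
        (Finset.mem_univ i)]
    have h3 : ∏ x ∈ Finset.univ.erase i, z x ^ (m.raise i hb).1 x /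
        (Real.sqrt (((m.raise i hb).1 x).factorial) : ℂ) =
        ∏ x ∈ Finset.univ.erase i, z x ^ m.1 x / (Real.sqrt ((m.1 x).factorial) : ℂ) := by
      refine Finset.prod_congr rfl fun j hj => ?_
      simp [Occ.raise, Finset.ne_of_mem_erase hj]
    have h4 : (m.raise i hb).1 i = m.1 i + 1 := by simp [Occ.raise]
    rw [h3, h4, Nat.factorial_succ]
    push_cast
    rw [Real.sqrt_mul (by positivity), pow_succ]
    have h5 : (Real.sqrt (m.1 i + 1) : ℂ) ≠ 0 := by
      rw [Complex.ofReal_ne_zero]; positivity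
    have h6 : (Real.sqrt ((m.1 i).factorial) : ℂ) ≠ 0 := by
      rw [Complex.ofReal_ne_zero]
      have := Nat.factorial_pos (m.1 i)
      positivity
    push_cast
    field_simp
  rw [anni_apply, crea_single_of _ _ _ hb, toFock_single, inner_smul_left, inner_ket_toFock,
    Finsupp.smul_apply, coh_apply, coh_apply, h1]
  simp only [phase, Statistics.sign, one_pow, one_mul, Complex.conj_ofReal, Nat.add_le_add_iff_right]
  split_ifs
  · rw [smul_eq_mul, ← h2]; ring
  · simp

theorem inner_coh {M M' : ℕ} (h : M ≤ M') (z : Fin N → ℂ) :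
    ⟪toFock (coh M' z), toFock (coh M z)⟫_ℂ = (‖toFock (coh M z)‖ ^ 2 : ℝ) := by
  have h1 := hasSum_inner_toFock (coh M' z) (coh M z)
  have h2 := hasSum_inner_toFock (coh M z) (coh M z)
  have h3 : ∀ n, star (coh M' z n) * coh M z n = star (coh M z n) * coh M z n := by
    intro n
    simp only [coh_apply]
    by_cases hn : n.num ≤ M
    · rw [if_pos hn, if_pos (hn.trans h)]
    · simp [hn]
  simp only [h3] at h1
  rw [h1.unique h2, inner_self_eq_norm_sq_to_K]
  norm_cast

theorem norm_coh_mono (z : Fin N → ℂ) : Monotone fun M => ‖toFock (coh M z)‖ ^ 2 := by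
  intro M M' h
  refine hasSum_le (fun n => ?_) (hasSum_norm_sq _) (hasSum_norm_sq _)
  simp only [toFock_apply, coh_apply]
  by_cases hn : n.num ≤ M
  · rw [if_pos hn, if_pos (hn.trans h)]
  · rw [if_neg hn, norm_zero, zero_pow two_ne_zero]
    positivity

theorem one_le_norm_coh (M : ℕ) (z : Fin N → ℂ) : 1 ≤ ‖toFock (coh M z)‖ ^ 2 := by
  have h1 := hasSum_norm_sq (toFock (coh M z))
  have h2 := le_hasSum h1 (⟨0, fun h => by cases h⟩ : Occ .boson N) fun _ _ => by positivity
  simpa [toFock_apply, coh_apply, Occ.num, cohCoeff] using h2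

theorem norm_coh_le (M : ℕ) (z : Fin N → ℂ) :
    ‖toFock (coh M z)‖ ^ 2 ≤ ∏ i, Real.exp (‖z i‖ ^ 2) := by
  classical
  refine hasSum_le_of_sum_le (hasSum_norm_sq _) fun F => ?_
  have h1 : ∀ n : Occ .boson N, ‖toFock (coh M z) n‖ ^ 2 ≤
      ∏ i, (‖z i‖ ^ 2) ^ n.1 i / (n.1 i).factorial := by
    intro n
    rw [toFock_apply, coh_apply]
    split_ifs
    · rw [cohCoeff, norm_prod, ← Finset.prod_pow]
      refine (Finset.prod_congr rfl fun i _ => ?_).le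
      rw [norm_div, div_pow, norm_pow, Complex.norm_real, Real.norm_eq_abs, sq_abs,
        Real.sq_sqrt (by positivity)]
      ring
    · simp only [norm_zero, ne_eq, OfNat.ofNat_ne_zero, not_false_eq_true, zero_pow]
      exact Finset.prod_nonneg fun i _ => by positivity
  refine (Finset.sum_le_sum fun n _ => h1 n).trans ?_
  have h2 := sum_prod_le (f := fun (i : Fin N) k => (‖z i‖ ^ 2) ^ k / (k.factorial : ℝ))
    (fun i k => by positivity) (B := fun i => Real.exp (‖z i‖ ^ 2))
    (fun i F => ?_) (F.image Subtype.val)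
  · rwa [Finset.sum_image fun a _ b _ h => Subtype.ext h] at h2
  · have h3 := Real.summable_pow_div_factorial (‖z i‖ ^ 2)
    rw [Real.exp_eq_exp_ℝ, NormedSpace.exp_eq_tsum_div]
    exact h3.sum_le_tsum _ fun _ _ => by positivity

theorem exists_tendsto_norm_coh (z : Fin N → ℂ) :
    ∃ L, 1 ≤ L ∧ Tendsto (fun M => ‖toFock (coh M z)‖ ^ 2) atTop (𝓝 L) := by
  have h := tendsto_atTop_ciSup (norm_coh_mono z)
    ⟨∏ i, Real.exp (‖z i‖ ^ 2), by rintro _ ⟨M, rfl⟩; exact norm_coh_le M z⟩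
  exact ⟨_, ge_of_tendsto' h fun M => one_le_norm_coh M z, h⟩

/-! ### Quadratic Hamiltonians of bosons -/

/-- The classical quadratic form. -/
def quadForm (A G : Matrix (Fin N) (Fin N) ℂ) (z : Fin N → ℂ) : ℝ :=
  (∑ i, ∑ j, A i j * (star (z i) * z j) + ∑ i, ∑ j, G i j * (z i * z j)).re

/-- The expectation value of the quadratic operator. -/
def quadExp (A G : Matrix (Fin N) (Fin N) ℂ) (Ψ : PreFock .boson N) : ℝ :=
  (∑ i, ∑ j, A i j * ⟪toFock (anni i Ψ), toFock (anni j Ψ)⟫_ℂ +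
    ∑ i, ∑ j, G i j * ⟪toFock Ψ, toFock (anni i (anni j Ψ))⟫_ℂ).re

/-- The expectation value of the linear operator `∑ γ_i a_i`. -/
def linExp (γ : Fin N → ℂ) (Ψ : PreFock .boson N) : ℝ :=
  (∑ i, γ i * ⟪toFock Ψ, toFock (anni i Ψ)⟫_ℂ).re

theorem inner_crea_crea (i j : Fin N) (Ψ : PreFock .boson N) :
    ⟪toFock (crea i Ψ), toFock (crea j Ψ)⟫_ℂ =
      ⟪toFock (anni j Ψ), toFock (anni i Ψ)⟫_ℂ + if i = j then ((‖toFock Ψ‖ ^ 2 : ℝ) : ℂ) else 0 := by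
  rw [adj_crea i, adj_anni j]
  have h := congrArg (fun B : PreOp .boson N => B Ψ) (anni_mul_crea (N := N) i j)
  simp only [Module.End.mul_apply, LinearMap.add_apply] at h
  rw [h, map_add, inner_add_right]
  congr 1
  split_ifs
  · rw [Module.End.one_apply, inner_self_eq_norm_sq_to_K]
    norm_cast
  · simp

/-- The two arguments are chosen so that the products of two `x` or of two conjugated `y` cancel.
Every surviving product has exactly one conjugated factor, so it sums to an inner product when `x`
and `y` are coordinates of vectors. -/
theorem quadForm_add_quadForm (A G : Matrix (Fin N) (Fin N) ℂ) (x y : Fin N → ℂ) :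
    quadForm A G (fun i => (x i + star (y i)) / 2) +
      quadForm A G (fun i => -Complex.I * (x i - star (y i)) / 2) =
    (∑ i, ∑ j, A i j / 2 * (star (x i) * x j + star (y j) * y i) +
      ∑ i, ∑ j, G i j / 2 * (star (y j) * x i + star (y i) * x j)).re := by
  unfold quadForm
  rw [← Complex.add_re]
  congr 1
  rw [add_add_add_comm, ← Finset.sum_add_distrib, ← Finset.sum_add_distrib]
  congr 1 <;> refine Finset.sum_congr rfl fun i _ => ?_ <;> rw [← Finset.sum_add_distrib] <;>
    refine Finset.sum_congr rfl fun j _ => ?_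
  · have h2 : star (2 : ℂ) = 2 := Complex.conj_ofNat 2
    have hI : star Complex.I = -Complex.I := Complex.conj_I
    simp only [star_div₀, star_add, star_sub, star_star, star_mul', star_neg, h2, hI]
    linear_combination (-(A i j) / 4 * (star (x i) - y i) * (x j - star (y j))) * Complex.I_sq
  · linear_combination (G i j / 4 * (x i - star (y i)) * (x j - star (y j))) * Complex.I_sq

/-- The classical bound is applied at each occupation state to the coordinates of `anni i Ψ` and
`crea i Ψ`, combined as in `quadForm_add_quadForm`, and summed. This gives the symmetrically ordered
operator; normal ordering it costs the term with half the trace of `A`. -/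
theorem quadExp_lower_bound {A G : Matrix (Fin N) (Fin N) ℂ} {c : ℝ} (hc : 0 < c)
    (h : ∀ z, c * ∑ i, ‖z i‖ ^ 2 ≤ quadForm A G z) (Ψ : PreFock .boson N) :
    c * numExp (fun k => (k : ℝ)) Ψ ≤ quadExp A G Ψ + (∑ i, A i i / 2).re * ‖toFock Ψ‖ ^ 2 := by
  set x : Fin N → PreFock .boson N := fun i => anni i Ψ with hx
  set y : Fin N → PreFock .boson N := fun i => crea i Ψ with hy
  have h1 : HasSum (fun m => quadForm A G (fun i => (x i m + star (y i m)) / 2) +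
      quadForm A G (fun i => -Complex.I * (x i m - star (y i m)) / 2))
      (∑ i, ∑ j, A i j / 2 * (⟪toFock (x i), toFock (x j)⟫_ℂ + ⟪toFock (y j), toFock (y i)⟫_ℂ) +
      ∑ i, ∑ j, G i j / 2 * (⟪toFock (y j), toFock (x i)⟫_ℂ + ⟪toFock (y i), toFock (x j)⟫_ℂ)).re := by
    simp only [quadForm_add_quadForm]
    refine Complex.hasSum_re (HasSum.add ?_ ?_) <;>
      exact hasSum_sum fun i _ => hasSum_sum fun j _ =>
        ((hasSum_inner_toFock _ _).add (hasSum_inner_toFock _ _)).mul_left _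
  have h2 : HasSum (fun m => c / 2 * ∑ i, (‖x i m‖ ^ 2 + ‖y i m‖ ^ 2))
      (c / 2 * ∑ i, (‖toFock (x i)‖ ^ 2 + ‖toFock (y i)‖ ^ 2)) := by
    refine HasSum.mul_left _ (hasSum_sum fun i _ => HasSum.add ?_ ?_)
    · simpa only [toFock_apply] using hasSum_norm_sq (toFock (x i))
    · simpa only [toFock_apply] using hasSum_norm_sq (toFock (y i))
  have h3 := hasSum_le (fun m => ?_) h2 h1
  · have h4 : ∀ i j, ⟪toFock (y j), toFock (y i)⟫_ℂ = ⟪toFock (x i), toFock (x j)⟫_ℂ +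
        if j = i then ((‖toFock Ψ‖ ^ 2 : ℝ) : ℂ) else 0 := fun i j => inner_crea_crea j i Ψ
    have h5 : ∀ i j, ⟪toFock (y i), toFock (x j)⟫_ℂ = ⟪toFock Ψ, toFock (anni i (anni j Ψ))⟫_ℂ :=
      fun i j => adj_crea i _ _
    have h6 : ∀ i j, ⟪toFock Ψ, toFock (anni j (anni i Ψ))⟫_ℂ =
        ⟪toFock Ψ, toFock (anni i (anni j Ψ))⟫_ℂ := fun i j => by
      have := congrArg (fun B : PreOp .boson N => B Ψ) (commute_anni (N := N) i j).eq
      simp only [Module.End.mul_apply] at this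
      rw [this]
    have h7 : ∑ i, ‖toFock (y i)‖ ^ 2 = numExp (fun k => (k : ℝ)) Ψ + N * ‖toFock Ψ‖ ^ 2 := by
      rw [← sum_norm_anni_sq]
      have h8 : ∀ i, ‖toFock (y i)‖ ^ 2 = ‖toFock (anni i Ψ)‖ ^ 2 + ‖toFock Ψ‖ ^ 2 := by
        intro i
        have h9 := h4 i i
        rw [inner_self_eq_ofReal, inner_self_eq_ofReal, if_pos rfl] at h9
        exact_mod_cast h9
      simp [h8, Finset.sum_add_distrib]
    have h8 : (∑ i, ∑ j, A i j / 2 * (⟪toFock (x i), toFock (x j)⟫_ℂ + ⟪toFock (y j), toFock (y i)⟫_ℂ) +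
        ∑ i, ∑ j, G i j / 2 * (⟪toFock (y j), toFock (x i)⟫_ℂ + ⟪toFock (y i), toFock (x j)⟫_ℂ)).re =
        quadExp A G Ψ + (∑ i, A i i / 2).re * ‖toFock Ψ‖ ^ 2 := by
      rw [quadExp, ← Complex.re_mul_ofReal, ← Complex.add_re]
      congr 1
      simp only [h4, h5, h6]
      have h10 : ∀ a b c d e : ℂ, a = d + e → b = c → a + b = d + c + e := by
        rintro a b c d e rfl rfl
        ring
      refine h10 _ _ _ _ _ ?_ ?_
      · rw [Finset.sum_mul, ← Finset.sum_add_distrib]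
        refine Finset.sum_congr rfl fun i _ => ?_
        simp only [mul_add, Finset.sum_add_distrib, mul_ite, mul_zero, Finset.sum_ite_eq',
          Finset.mem_univ, if_true]
        rw [← add_assoc, ← Finset.sum_add_distrib]
        congr 1
        exact Finset.sum_congr rfl fun j _ => by ring
      · exact Finset.sum_congr rfl fun i _ => Finset.sum_congr rfl fun j _ => by ring
    rw [h8, Finset.sum_add_distrib, h7, sum_norm_anni_sq] at h3
    have : 0 ≤ c / 2 * (N * ‖toFock Ψ‖ ^ 2) := by positivity
    linarith
  · refine le_trans (le_of_eq ?_) (add_le_add (h _) (h _))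
    rw [← mul_add, ← Finset.sum_add_distrib, Finset.mul_sum, Finset.mul_sum]
    refine Finset.sum_congr rfl fun i _ => ?_
    have h4 := parallelogram_law_with_norm ℝ (x i m) (star (y i m))
    simp only [norm_div, norm_mul, norm_neg, Complex.norm_I, one_mul, norm_star, div_pow,
      Complex.norm_ofNat] at h4 ⊢
    linear_combination (-c / 4) * h4

theorem linExp_ge (γ : Fin N → ℂ) {δ : ℝ} (hδ : 0 < δ) : ∃ C, ∀ Ψ : PreFock .boson N,
    -linExp γ Ψ ≤ δ * numExp (fun k => (k : ℝ)) Ψ + C * ‖toFock Ψ‖ ^ 2 := by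
  set g := ∑ i, ‖γ i‖ with hg
  have hg0 : 0 ≤ g := Finset.sum_nonneg fun _ _ => norm_nonneg _
  -- Weight of the arithmetic-geometric mean inequality, chosen so that g η ≤ δ, also when g = 0.
  set η := δ / (g + 1) with hη
  have hη0 : 0 < η := by positivity
  refine ⟨g * (1 / (4 * η)), fun Ψ => ?_⟩
  have h1 : |linExp γ Ψ| ≤ g * (η * numExp (fun k => (k : ℝ)) Ψ + 1 / (4 * η) * ‖toFock Ψ‖ ^ 2) := by
    refine (Complex.abs_re_le_norm _).trans ?_
    rw [hg, Finset.sum_mul]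
    refine norm_sum_le_of_le _ fun i _ => ?_
    rw [norm_mul]
    refine mul_le_mul_of_nonneg_left ?_ (norm_nonneg _)
    refine (norm_inner_le_norm _ _).trans ?_
    have h2 := norm_anni_sq_le i Ψ
    have h3 : ‖toFock Ψ‖ * ‖toFock (anni i Ψ)‖ ≤
        η * ‖toFock (anni i Ψ)‖ ^ 2 + 1 / (4 * η) * ‖toFock Ψ‖ ^ 2 := by
      have h4 : η * ‖toFock (anni i Ψ)‖ ^ 2 + 1 / (4 * η) * ‖toFock Ψ‖ ^ 2 -
          ‖toFock Ψ‖ * ‖toFock (anni i Ψ)‖ =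
          η * (‖toFock (anni i Ψ)‖ - ‖toFock Ψ‖ / (2 * η)) ^ 2 := by
        field_simp
        ring
      have h5 : 0 ≤ η * (‖toFock (anni i Ψ)‖ - ‖toFock Ψ‖ / (2 * η)) ^ 2 := by positivity
      linarith
    nlinarith
  have h2 : g * η ≤ δ := by
    rw [hη, mul_div_assoc', div_le_iff₀ (by positivity)]
    nlinarith
  have h3 := neg_le_of_abs_le h1
  have h4 : 0 ≤ numExp (fun k => (k : ℝ)) Ψ := numExp_nonneg (fun k => by positivity) Ψ
  nlinarith

/-- If the form is nonpositive at `z`, the coherent states at `t • z` have energy at most about `e`.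
They tend weakly to zero as t grows, contradicting `EigenData.not_weakly_null`. -/
theorem quadForm_pos_of_eigenData {B : PreOp .boson N} (hB : IsHermitianOp B) {β : ℝ} (hβ : 0 < β)
    (D : EigenData B β) {e : ℝ} {A G : Matrix (Fin N) (Fin N) ℂ} {γ : Fin N → ℂ}
    (h : ∀ Ψ, expect B Ψ = e * ‖toFock Ψ‖ ^ 2 + quadExp A G Ψ + linExp γ Ψ) (z : Fin N → ℂ)
    (hz : z ≠ 0) : 0 < quadForm A G z := by
  by_contra! hq
  -- The quadratic form is even, so the sign of `z` is free to make the linear term nonpositive.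
  wlog hl : (∑ i, γ i * z i).re ≤ 0 generalizing z
  · refine this (-z) (neg_ne_zero.2 hz) ?_ ?_
    · have : quadForm A G (-z) = quadForm A G z := by simp [quadForm]
      rwa [this]
    · simp only [Pi.neg_apply, mul_neg, Finset.sum_neg_distrib, Complex.neg_re]
      linarith
  obtain ⟨i0, hi0⟩ : ∃ i, z i ≠ 0 := by
    by_contra! h0
    exact hz (funext h0)
  -- the energy of a truncated coherent state
  have hexp : ∀ (M : ℕ) (z : Fin N → ℂ), expect B (coh (M + 2) z) =
      e * ‖toFock (coh (M + 2) z)‖ ^ 2 +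
      ((∑ i, ∑ j, A i j * (star (z i) * z j)).re * ‖toFock (coh (M + 1) z)‖ ^ 2 +
      (∑ i, ∑ j, G i j * (z i * z j)).re * ‖toFock (coh M z)‖ ^ 2) +
      (∑ i, γ i * z i).re * ‖toFock (coh (M + 1) z)‖ ^ 2 := by
    intro M z
    rw [h, quadExp, linExp]
    simp only [anni_coh, map_smul, inner_smul_left, inner_smul_right, inner_coh le_rfl,
      inner_coh (show M + 1 ≤ M + 2 by omega), inner_coh (show M ≤ M + 2 by omega)]
    rw [← Complex.re_mul_ofReal, ← Complex.re_mul_ofReal, ← Complex.re_mul_ofReal, ← Complex.add_re]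
    simp only [Finset.sum_mul, starRingEnd_apply]
    refine congrArg₂ (· + ·) (congrArg₂ (· + ·) rfl (congrArg Complex.re
      (congrArg₂ (· + ·) ?_ ?_))) (congrArg Complex.re ?_)
    · exact Finset.sum_congr rfl fun i _ => Finset.sum_congr rfl fun j _ => by ring
    · exact Finset.sum_congr rfl fun i _ => Finset.sum_congr rfl fun j _ => by ring
    · exact Finset.sum_congr rfl fun i _ => by ring
  -- The squared norms at consecutive cutoffs share a limit L ≥ 1, so a large cutoff depending on
  -- `t` works. The `1` in `e + 1` absorbs the truncation error; any factor above 1 would do for the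
  -- `4`.
  have hex : ∀ t : ℕ, ∃ M, expect B (coh (M + 2) (((t : ℝ) : ℂ) • z)) ≤
      (e + 1) * ‖toFock (coh (M + 2) (((t : ℝ) : ℂ) • z))‖ ^ 2 ∧
      ‖toFock (coh (M + 3) (((t : ℝ) : ℂ) • z))‖ ^ 2 ≤
        4 * ‖toFock (coh (M + 2) (((t : ℝ) : ℂ) • z))‖ ^ 2 := by
    intro t
    set y := ((t : ℝ) : ℂ) • z with hy
    obtain ⟨L, hL1, hL⟩ := exists_tendsto_norm_coh y
    have hL' : ∀ k, Tendsto (fun M => ‖toFock (coh (M + k) y)‖ ^ 2) atTop (𝓝 L) := fun k =>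
      hL.comp (tendsto_add_atTop_nat k)
    have h1 : Tendsto (fun M => expect B (coh (M + 2) y)) atTop (𝓝 (e * L +
        ((∑ i, ∑ j, A i j * (star (y i) * y j)).re * L + (∑ i, ∑ j, G i j * (y i * y j)).re * L) +
        (∑ i, γ i * y i).re * L)) := by
      simp only [hexp]
      exact (((hL' 2).const_mul _).add (((hL' 1).const_mul _).add (hL.const_mul _))).add
        ((hL' 1).const_mul _)
    have h2 : quadForm A G y ≤ 0 := by
      have : quadForm A G y = (t : ℝ) ^ 2 * quadForm A G z := by
        rw [quadForm, quadForm, ← Complex.re_ofReal_mul, mul_add, Finset.mul_sum, Finset.mul_sum]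
        congr 2 <;> refine Finset.sum_congr rfl fun i _ => ?_ <;> rw [Finset.mul_sum] <;>
          refine Finset.sum_congr rfl fun j _ => ?_ <;>
          simp only [hy, Pi.smul_apply, smul_eq_mul, star_mul',
            show ∀ r : ℝ, star (r : ℂ) = r from Complex.conj_ofReal] <;> push_cast <;> ring
      rw [this]
      exact mul_nonpos_of_nonneg_of_nonpos (by positivity) hq
    have h3 : (∑ i, γ i * y i).re ≤ 0 := by
      have : (∑ i, γ i * y i).re = (t : ℝ) * (∑ i, γ i * z i).re := by
        rw [← Complex.re_ofReal_mul, Finset.mul_sum]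
        congr 1
        exact Finset.sum_congr rfl fun i _ => by simp only [hy, Pi.smul_apply, smul_eq_mul]; ring
      rw [this]
      exact mul_nonpos_of_nonneg_of_nonpos (by positivity) hl
    have h4 : e * L + ((∑ i, ∑ j, A i j * (star (y i) * y j)).re * L +
        (∑ i, ∑ j, G i j * (y i * y j)).re * L) + (∑ i, γ i * y i).re * L < (e + 1) * L := by
      rw [quadForm, Complex.add_re] at h2
      nlinarith
    have h5 := h1.eventually_lt ((hL' 2).const_mul (e + 1)) h4
    have h6 := (hL' 3).eventually_lt ((hL' 2).const_mul 4) (by linarith)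
    obtain ⟨M, hM1, hM2⟩ := (h5.and h6).exists
    exact ⟨M, hM1.le, hM2.le⟩
  choose M hM1 hM2 using hex
  set Φ : ℕ → PreFock .boson N := fun t => coh (M t + 2) (((t : ℝ) : ℂ) • z) with hΦ
  have hpos : ∀ t, 0 < ‖toFock (Φ t)‖ := fun t => by
    have := one_le_norm_coh (M t + 2) (((t : ℝ) : ℂ) • z)
    by_contra! h0
    have h0' := le_antisymm h0 (norm_nonneg _)
    rw [hΦ] at h0'
    simp only at h0'
    rw [h0'] at this
    norm_num at this
  refine D.not_weakly_null hβ hB (φ := fun t => ((‖toFock (Φ t)‖⁻¹ : ℝ) : ℂ) • Φ t) (K := e + 1)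
    (fun t => ?_) (fun t => ?_) (fun χ => ?_)
  · rw [map_smul, norm_smul, Complex.norm_real, norm_inv, norm_norm]
    exact inv_mul_cancel₀ (hpos t).ne'
  · have h1 : expect B (((‖toFock (Φ t)‖⁻¹ : ℝ) : ℂ) • Φ t) =
        ‖toFock (Φ t)‖⁻¹ ^ 2 * expect B (Φ t) := by
      simp only [expect, map_smul, inner_smul_left, inner_smul_right, Complex.conj_ofReal,
        Complex.re_ofReal_mul]
      ring
    rw [h1]
    have h2 := mul_le_mul_of_nonneg_left (hM1 t) (show 0 ≤ ‖toFock (Φ t)‖⁻¹ ^ 2 by positivity)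
    refine h2.trans_eq ?_
    have := (hpos t).ne'
    change ‖toFock (Φ t)‖⁻¹ ^ 2 * ((e + 1) * ‖toFock (Φ t)‖ ^ 2) = e + 1
    field_simp
  · rw [tendsto_zero_iff_norm_tendsto_zero]
    have h1 : Tendsto (fun t : ℕ => 2 * ‖toFock (crea i0 χ)‖ / ‖z i0‖ / (t : ℝ)) atTop (𝓝 0) :=
      tendsto_const_div_atTop_nhds_zero_nat _
    refine tendsto_of_tendsto_of_tendsto_of_le_of_le' tendsto_const_nhds h1
      (Eventually.of_forall fun _ => norm_nonneg _) ?_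
    filter_upwards [eventually_gt_atTop 0] with t ht
    -- Moving `crea i0` across the inner product yields the eigenvalue t z_{i0}, hence decay of the
    -- overlap like 1/t. It lowers the cutoff from M + 3 to M + 2, whence the second bound in `hex`.
    have h2 : (((t : ℝ) : ℂ) * z i0) * ⟪toFock χ, toFock (Φ t)⟫_ℂ =
        ⟪toFock (crea i0 χ), toFock (coh (M t + 3) (((t : ℝ) : ℂ) • z))⟫_ℂ := by
      rw [adj_crea i0, anni_coh, map_smul, inner_smul_right]
      rfl
    have h3 := norm_inner_le_norm (𝕜 := ℂ) (toFock (crea i0 χ))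
      (toFock (coh (M t + 3) (((t : ℝ) : ℂ) • z)))
    rw [← h2, norm_mul, norm_mul, Complex.norm_real, Real.norm_natCast] at h3
    have h4 : ‖toFock (coh (M t + 3) (((t : ℝ) : ℂ) • z))‖ ≤ 2 * ‖toFock (Φ t)‖ := by
      refine abs_le_of_sq_le_sq' ?_ (by positivity) |>.2
      rw [mul_pow]
      norm_num
      exact hM2 t
    have h5 : (0 : ℝ) < t := by exact_mod_cast ht
    have h6 : 0 < ‖z i0‖ := norm_pos_iff.2 hi0
    rw [map_smul, inner_smul_right, norm_mul, Complex.norm_real, norm_inv, norm_norm,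
      inv_mul_le_iff₀ (hpos t), div_div, mul_div_assoc', le_div_iff₀ (by positivity)]
    nlinarith [norm_nonneg (toFock (crea i0 χ))]

/-- Strict positivity of the classical form gives a constant `c`; half of it is spent on the linear
term. -/
theorem dominatesNumber_quadratic {B : PreOp .boson N} (hB : IsHermitianOp B) {β : ℝ} (hβ : 0 < β)
    (D : EigenData B β) {e : ℝ} {A G : Matrix (Fin N) (Fin N) ℂ} {γ : Fin N → ℂ}
    (h : ∀ Ψ, expect B Ψ = e * ‖toFock Ψ‖ ^ 2 + quadExp A G Ψ + linExp γ Ψ) :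
    DominatesNumber B := by
  obtain ⟨c, hc, hle⟩ := exists_pos_mul_sum_sq_le (S := Set.univ) (f := quadForm A G) isClosed_univ
    (fun _ _ _ => trivial) (by unfold quadForm; fun_prop)
    (fun r z => by
      rw [quadForm, quadForm, ← Complex.re_ofReal_mul, mul_add, Finset.mul_sum, Finset.mul_sum]
      congr 2 <;> refine Finset.sum_congr rfl fun i _ => ?_ <;> rw [Finset.mul_sum] <;>
        refine Finset.sum_congr rfl fun j _ => ?_ <;>
        simp only [Pi.smul_apply, smul_eq_mul, star_mul',
          show ∀ r : ℝ, star (r : ℂ) = r from Complex.conj_ofReal] <;> push_cast <;> ring)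
    (fun z _ hz => quadForm_pos_of_eigenData hB hβ D h z hz)
  obtain ⟨C, hC⟩ := linExp_ge γ (half_pos hc)
  refine ⟨c / 2, half_pos hc, (∑ i, A i i / 2).re + C - e, fun Ψ => ?_⟩
  have h1 := quadExp_lower_bound hc (fun z => hle z trivial) Ψ
  have h2 := hC Ψ
  rw [h]
  linarith

/-! ### Reduction of Hamiltonians with `nmax = 1` to quadratic form -/

theorem linExp_add (γ γ' : Fin N → ℂ) (Ψ : PreFock .boson N) :
    linExp (γ + γ') Ψ = linExp γ Ψ + linExp γ' Ψ := by
  simp [linExp, add_mul, Finset.sum_add_distrib]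

theorem linExp_single (c : ℂ) (i : Fin N) (Ψ : PreFock .boson N) :
    linExp (Pi.single i c) Ψ = (c * ⟪toFock Ψ, toFock (anni i Ψ)⟫_ℂ).re := by
  rw [linExp, Finset.sum_eq_single i]
  · simp
  · intro j _ hj
    simp [hj]
  · simp

theorem quadExp_add (A A' G G' : Matrix (Fin N) (Fin N) ℂ) (Ψ : PreFock .boson N) :
    quadExp (A + A') (G + G') Ψ = quadExp A G Ψ + quadExp A' G' Ψ := by
  simp only [quadExp, Matrix.add_apply, add_mul, Finset.sum_add_distrib, Complex.add_re]
  ring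

theorem quadExp_single (c : ℂ) (i j : Fin N) (Ψ : PreFock .boson N) :
    quadExp 0 (Matrix.single i j c) Ψ = (c * ⟪toFock Ψ, toFock (anni i (anni j Ψ))⟫_ℂ).re := by
  have h : ∀ f : Fin N → Fin N → ℂ,
      ∑ i', ∑ j', Matrix.single i j c i' j' * f i' j' = c * f i j := fun f => by
    rw [Finset.sum_eq_single i, Finset.sum_eq_single j]
    · simp
    · intro k _ hk
      simp [hk.symm]
    · simp
    · intro k _ hk
      simp [hk.symm]
    · simp
  rw [quadExp, h fun i j => ⟪toFock Ψ, toFock (anni i (anni j Ψ))⟫_ℂ]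
  simp

theorem re_mul_conj_eq (c x : ℂ) : (c * (starRingEnd ℂ) x).re = (star c * x).re := by
  simp [Complex.mul_re]

/-- Strings of at most two ladder operators that change the particle number. -/
theorem exists_quadExp_of_string {l : List (Fin N ⊕ Fin N)} (hl : l.length ≤ 2)
    (hne : l.countP Sum.isLeft ≠ l.countP Sum.isRight) (c : ℂ) :
    ∃ (G : Matrix (Fin N) (Fin N) ℂ) (γ : Fin N → ℂ), ∀ Ψ : PreFock .boson N,
      (c * ⟪toFock Ψ, toFock ((l.map ladder).prod Ψ)⟫_ℂ).re = quadExp 0 G Ψ + linExp γ Ψ := by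
  have hq : ∀ Ψ : PreFock .boson N, quadExp 0 0 Ψ = 0 := fun Ψ => by simp [quadExp]
  have hz : ∀ Ψ : PreFock .boson N, linExp 0 Ψ = 0 := fun Ψ => by simp [linExp]
  match l, hl, hne with
  | [], _, hne => simp at hne
  | [.inl i], _, _ =>
    refine ⟨0, Pi.single i (star c), fun Ψ => ?_⟩
    rw [hq, linExp_single, zero_add, ← re_mul_conj_eq, inner_conj_symm, adj_anni]
    simp [ladder]
  | [.inr i], _, _ =>
    refine ⟨0, Pi.single i c, fun Ψ => ?_⟩
    rw [hq, linExp_single, zero_add]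
    simp [ladder]
  | [.inl i, .inl j], _, _ =>
    -- Only the real part matters, so a pair of creators may be replaced by its adjoint, which
    -- reverses the order of the indices.
    refine ⟨Matrix.single j i (star c), 0, fun Ψ => ?_⟩
    rw [hz, quadExp_single, add_zero, ← re_mul_conj_eq, inner_conj_symm, adj_anni, adj_anni]
    simp [ladder]
  | [.inl i, .inr j], _, hne => exact (hne rfl).elim
  | [.inr i, .inl j], _, hne => exact (hne rfl).elim
  | [.inr i, .inr j], _, _ =>
    refine ⟨Matrix.single i j c, 0, fun Ψ => ?_⟩
    rw [hz, quadExp_single, add_zero]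
    simp [ladder]
  | _ :: _ :: _ :: _, hl, _ => simp at hl

/-- The real part is not complex linear; the free coefficient `c` absorbs the scalars in the
induction over the span. -/
theorem exists_quadExp_of_nonConserving {A : PreOp .boson N}
    (hA : A ∈ nonConserving Statistics.boson N 2) (c : ℂ) :
    ∃ (G : Matrix (Fin N) (Fin N) ℂ) (γ : Fin N → ℂ), ∀ Ψ : PreFock .boson N,
      (c * ⟪toFock Ψ, toFock (A Ψ)⟫_ℂ).re = quadExp 0 G Ψ + linExp γ Ψ := by
  unfold nonConserving at hA
  induction hA using Submodule.span_induction generalizing c with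
  | mem A h =>
    obtain ⟨l, hl, hne, rfl⟩ := h
    exact exists_quadExp_of_string hl hne c
  | zero => exact ⟨0, 0, fun Ψ => by simp [quadExp, linExp]⟩
  | add A B _ _ hA hB =>
    obtain ⟨G, γ, h⟩ := hA c
    obtain ⟨G', γ', h'⟩ := hB c
    refine ⟨G + G', γ + γ', fun Ψ => ?_⟩
    have h0 : quadExp 0 (G + G') Ψ = quadExp 0 G Ψ + quadExp 0 G' Ψ := by
      rw [← quadExp_add, add_zero]
    rw [h0, linExp_add, LinearMap.add_apply, map_add, inner_add_right, mul_add, Complex.add_re,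
      h, h']
    ring
  | smul r A _ hA =>
    obtain ⟨G, γ, h⟩ := hA (c * r)
    refine ⟨G, γ, fun Ψ => ?_⟩
    rw [← h, LinearMap.smul_apply, map_smul, inner_smul_right, mul_assoc]

theorem exists_quadExp (H : Hamiltonian .boson N) (hn : H.nmax = 1) (v : Matrix (Fin N) (Fin N) ℂ) :
    ∃ (e : ℝ) (A G : Matrix (Fin N) (Fin N) ℂ) (γ : Fin N → ℂ), ∀ Ψ,
      expect (H.withPot v) Ψ = e * ‖toFock Ψ‖ ^ 2 + quadExp A G Ψ + linExp γ Ψ := by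
  have hnc := H.nc_mem
  rw [hn] at hnc
  obtain ⟨G, γ, h⟩ := exists_quadExp_of_nonConserving hnc 1
  let ε := Equiv.funUnique (Fin 1) (Fin N)
  refine ⟨(H.h 0 default default).re, Matrix.of (fun i j => H.h 1 (ε.symm i) (ε.symm j)) + v, 0 + G, γ,
    fun Ψ => ?_⟩
  have h0 : expect (nBody 0 (H.h 0)) Ψ = (H.h 0 default default).re * ‖toFock Ψ‖ ^ 2 := by
    rw [expect, inner_nBody, Fintype.sum_unique, Fintype.sum_unique, ← Complex.re_mul_ofReal]
    congr 2
    simp [annis, inner_self_eq_norm_sq_to_K]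
  have h1 : expect (nBody 1 (H.h 1)) Ψ =
      quadExp (Matrix.of fun i j => H.h 1 (ε.symm i) (ε.symm j)) 0 Ψ := by
    rw [expect, inner_nBody, quadExp, ← ε.symm.sum_comp]
    congr 1
    have h2 : ∀ i, annis (ε.symm i) Ψ = anni i Ψ := by
      intro i
      simp [annis, ε]
    simp only [h2, Matrix.zero_apply, zero_mul, Finset.sum_const_zero, add_zero, Matrix.of_apply]
    refine Finset.sum_congr rfl fun i _ => ?_
    rw [← ε.symm.sum_comp]
    simp only [h2]
  have h2 : expect (potential v) Ψ = quadExp v 0 Ψ := by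
    rw [expect, inner_potential, quadExp]
    simp
  have h3 : expect H.nc Ψ = quadExp 0 G Ψ + linExp γ Ψ := by
    rw [← h, one_mul, expect]
  have h4 : quadExp v G Ψ = quadExp v 0 Ψ + quadExp 0 G Ψ := by
    rw [← quadExp_add, add_zero, zero_add]
  rw [Hamiltonian.withPot, Hamiltonian.op, expect_add, expect_add, expect_sum, hn,
    Finset.sum_range_succ, Finset.sum_range_one, h0, h1, h2, h3, quadExp_add, h4]
  ring

theorem Hamiltonian.dominatesNumber (H : Hamiltonian s N) {β : ℝ} (hβ : 0 < β)
    {v : Matrix (Fin N) (Fin N) ℂ} (hv : v.IsHermitian) (D : EigenData (H.withPot v) β) :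
    DominatesNumber (H.withPot v) := by
  cases s with
  | fermion => exact dominatesNumber_fermion D.bounded_below
  | boson =>
    have := H.nmax_pos
    rcases (show H.nmax = 1 ∨ 2 ≤ H.nmax by omega) with h | h
    · obtain ⟨e, A, G, γ, hq⟩ := exists_quadExp H h v
      exact dominatesNumber_quadratic (H.withPot_hermitian hv) hβ D hq
    · exact dominatesNumber_of_two_le H h v

/-! ### Particle number in the eigenstates -/

/-- `y i` is the vector `a_i b`, and both are approximated by vectors of finite length such that the
expectation value of `A` converges to `E`. -/
structure IsLowered (A : PreOp s N) (b : Fock s N) (E : ℝ) (u : ℕ → PreFock s N)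
    (y : Fin N → Fock s N) : Prop where
  tendsto : Tendsto (fun k => toFock (u k)) atTop (𝓝 b)
  tendsto_expect : Tendsto (fun k => expect A (u k)) atTop (𝓝 E)
  tendsto_anni : ∀ i, Tendsto (fun k => toFock (anni i (u k))) atTop (𝓝 (y i))

/-- Domination bounds the squared norm of `anni i` on differences by the shifted form, so a
form-Cauchy sequence stays Cauchy after annihilation. -/
theorem FriedrichsMaps.exists_isLowered {A : PreOp s N} (hA : IsHermitianOp A)
    (hd : DominatesNumber A) {b : Fock s N} {E : ℝ} (h : FriedrichsMaps A b ((E : ℂ) • b))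
    (hb : ‖b‖ = 1) : ∃ u y, IsLowered A b E u y := by
  obtain ⟨c, hc, C, hC⟩ := hd
  obtain ⟨u, hu⟩ := h.exists_isApprox C
  have hB : IsNonnegOp (A + (C : ℂ) • 1) := ⟨hA.shift C, fun Ψ => by
    rw [expect_shift]
    exact (mul_nonneg hc.le (numExp_nonneg (fun k => by positivity) Ψ)).trans (hC Ψ)⟩
  have hcs : ∀ i, CauchySeq fun k => toFock (anni i (u k)) := by
    intro i
    rw [Metric.cauchySeq_iff]
    intro ε hε
    obtain ⟨m, hm⟩ := exists_forall_of_tendsto_prod hu.cauchy (show 0 < c * ε ^ 2 by positivity)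
    refine ⟨m, fun p hp q hq => ?_⟩
    have h1 := hm p hp q hq
    dsimp only at h1
    rw [expect_shift] at h1
    have h2 := hC (u p - u q)
    have h3 := norm_anni_sq_le i (u p - u q)
    rw [dist_eq_norm, ← map_sub, ← map_sub]
    refine lt_of_pow_lt_pow_left₀ 2 hε.le ?_
    nlinarith
  choose y hy using fun i => cauchySeq_tendsto_of_complete (hcs i)
  refine ⟨u, y, hu.tendsto, ?_, hy⟩
  have h1 := hu.tendsto_expect hB hb
  have h2 := (hu.tendsto.norm.pow 2).const_mul C
  rw [hb] at h2
  have h3 := h1.sub h2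
  simp only [expect_shift] at h3
  simpa using h3

section IsLowered

variable {A : PreOp s N} {b : Fock s N} {E : ℝ} {u : ℕ → PreFock s N} {y : Fin N → Fock s N}

theorem IsLowered.inner_eq (h : IsLowered A b E u y) (i : Fin N) (χ : PreFock s N) :
    ⟪toFock χ, y i⟫_ℂ = ⟪toFock (crea i χ), b⟫_ℂ := by
  refine tendsto_nhds_unique (tendsto_const_nhds.inner (h.tendsto_anni i)) ?_
  simp only [← adj_crea i _ _]
  exact tendsto_const_nhds.inner h.tendsto

theorem IsLowered.tendsto_numExp (h : IsLowered A b E u y) :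
    Tendsto (fun k => numExp (fun k => (k : ℝ)) (u k)) atTop (𝓝 (∑ i, ‖y i‖ ^ 2)) := by
  simp only [← sum_norm_anni_sq]
  exact tendsto_finsetSum _ fun i _ => (h.tendsto_anni i).norm.pow 2

theorem IsLowered.number_le (h : IsLowered A b E u y) (hb : ‖b‖ = 1) {c C : ℝ}
    (hC : ∀ Ψ : PreFock s N, c * numExp (fun k => (k : ℝ)) Ψ ≤ expect A Ψ + C * ‖toFock Ψ‖ ^ 2) :
    c * ∑ i, ‖y i‖ ^ 2 ≤ E + C := by
  have h1 := h.tendsto_expect.add ((h.tendsto.norm.pow 2).const_mul C)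
  rw [hb, one_pow, mul_one] at h1
  exact le_of_tendsto_of_tendsto' (h.tendsto_numExp.const_mul c) h1 fun k => hC _

theorem IsLowered.sum_num_le (h : IsLowered A b E u y) (F : Finset (Occ s N)) :
    ∑ n ∈ F, (n.num : ℝ) * ‖b n‖ ^ 2 ≤ ∑ i, ‖y i‖ ^ 2 := by
  have h1 : Tendsto (fun k => ∑ n ∈ F, (n.num : ℝ) * ‖u k n‖ ^ 2) atTop
      (𝓝 (∑ n ∈ F, (n.num : ℝ) * ‖b n‖ ^ 2)) := by
    refine tendsto_finsetSum _ fun n _ => Tendsto.const_mul _ (Tendsto.pow (Tendsto.norm ?_) 2)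
    have := (tendsto_const_nhds (x := ket n)).inner (𝕜 := ℂ) h.tendsto
    simpa only [inner_ket, toFock_apply] using this
  exact le_of_tendsto_of_tendsto' h1 h.tendsto_numExp fun k =>
    sum_le_hasSum F (fun _ _ => by positivity) (hasSum_numExp (fun k => (k : ℝ)) (u k))

/-- Jensen's inequality for the exponential of the particle number. -/
theorem IsLowered.exp_le (h : IsLowered A b E u y) (hb : ‖b‖ = 1) {t : ℝ} (ht : 0 ≤ t) :
    Real.exp (-t * ∑ i, ‖y i‖ ^ 2) ≤ ∑' n : Occ s N, Real.exp (-t * n.num) * ‖b n‖ ^ 2 := by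
  set ν := ∑ i, ‖y i‖ ^ 2 with hν
  have h1 : Summable fun n : Occ s N => (n.num : ℝ) * ‖b n‖ ^ 2 :=
    summable_of_sum_le (fun _ => by positivity) h.sum_num_le
  have h2 : ∑' n : Occ s N, (n.num : ℝ) * ‖b n‖ ^ 2 ≤ ν := h1.tsum_le_of_sum_le h.sum_num_le
  have h3 := hasSum_norm_sq b
  rw [hb, one_pow] at h3
  -- The tangent line of the exponential at `ν`. As t ≥ 0, it suffices that `ν` bounds the mean
  -- particle number from above.
  have h4 : HasSum (fun n : Occ s N => Real.exp (-t * ν) *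
      ((1 + t * ν) * ‖b n‖ ^ 2 - t * (n.num * ‖b n‖ ^ 2)))
      (Real.exp (-t * ν) * ((1 + t * ν) * 1 - t * ∑' n : Occ s N, (n.num : ℝ) * ‖b n‖ ^ 2)) :=
    ((h3.mul_left _).sub (h1.hasSum.mul_left _)).mul_left _
  have h5 : Summable fun n : Occ s N => Real.exp (-t * n.num) * ‖b n‖ ^ 2 := by
    refine Summable.of_nonneg_of_le (fun _ => by positivity) (fun n => ?_) h3.summable
    refine mul_le_of_le_one_left (by positivity) (Real.exp_le_one_iff.2 ?_)
    have : 0 ≤ t * (n.num : ℝ) := by positivity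
    linarith
  have h6 := hasSum_le (fun n => ?_) h4 h5.hasSum
  · refine le_trans ?_ h6
    refine le_mul_of_one_le_right (Real.exp_pos _).le ?_
    nlinarith
  · have h7 := Real.add_one_le_exp (t * ν - t * n.num)
    have h8 : Real.exp (-t * n.num) = Real.exp (-t * ν) * Real.exp (t * ν - t * n.num) := by
      rw [← Real.exp_add]; ring_nf
    rw [h8]
    have h9 : (1 + t * ν) * ‖b n‖ ^ 2 - t * (n.num * ‖b n‖ ^ 2) =
        (t * ν - t * n.num + 1) * ‖b n‖ ^ 2 := by ring
    rw [h9, mul_assoc]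
    exact mul_le_mul_of_nonneg_left (mul_le_mul_of_nonneg_right h7 (by positivity))
      (Real.exp_pos _).le

end IsLowered

/-! ### Finiteness of the trace at every temperature -/

theorem summable_exp_num {t : ℝ} (ht : 0 < t) :
    Summable fun n : Occ s N => Real.exp (-t * n.num) := by
  classical
  refine summable_of_sum_le (c := ∏ _i : Fin N, (1 - Real.exp (-t))⁻¹) (fun _ => (Real.exp_pos _).le)
    fun F => ?_
  have hr : Real.exp (-t) < 1 := by
    rw [← Real.exp_zero]
    exact Real.exp_lt_exp.2 (by linarith)
  have h1 := sum_prod_le (f := fun (_ : Fin N) k => Real.exp (-t) ^ k) (fun i k => by positivity)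
    (B := fun _ => (1 - Real.exp (-t))⁻¹) (fun i F => ?_) (F.image Subtype.val)
  · rw [Finset.sum_image fun a _ b _ h => Subtype.ext h] at h1
    refine le_trans (Finset.sum_le_sum fun n _ => le_of_eq ?_) h1
    rw [Finset.prod_pow_eq_pow_sum, ← Real.exp_nat_mul, Occ.num]
    ring_nf
  · rw [← tsum_geometric_of_lt_one (Real.exp_pos _).le hr]
    exact (summable_geometric_of_lt_one (Real.exp_pos _).le hr).sum_le_tsum _
      fun _ _ => by positivity

theorem HilbertBasis.hasSum_norm_apply_sq (b : HilbertBasis (Occ s N) ℂ (Fock s N)) (n : Occ s N) :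
    HasSum (fun k => ‖b k n‖ ^ 2) 1 := by
  have h := HilbertBasis.hasSum_norm_inner_sq b (ket n)
  simp only [fun k => norm_inner_symm (𝕜 := ℂ) (b k) (ket n), inner_ket] at h
  have h2 : ‖ket n‖ = 1 := by
    have h3 := inner_ket n (ket n)
    rw [inner_self_eq_ofReal] at h3
    have h4 : (ket n : Fock s N) n = 1 := by
      classical
      unfold ket
      rw [lp.single_apply_self]
    rw [h4] at h3
    have h5 : ‖ket n‖ ^ 2 = 1 := by exact_mod_cast h3
    exact (pow_eq_one_iff_of_nonneg (norm_nonneg _) two_ne_zero).1 h5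
  rwa [h2, one_pow] at h

/-- The eigenbasis together with the vectors `a_i b_k`. -/
structure LoweredData (A : PreOp s N) (β : ℝ) extends EigenData A β where
  u : Occ s N → ℕ → PreFock s N
  y : Occ s N → Fin N → Fock s N
  lowered : ∀ k, IsLowered A (b k) (E k) (u k) (y k)

section LoweredData

variable {A : PreOp s N} {β : ℝ}

theorem EigenData.exists_loweredData (hA : IsHermitianOp A) (hd : DominatesNumber A)
    (D : EigenData A β) : ∃ L : LoweredData A β, L.toEigenData = D := by
  choose u y h using fun k => (D.maps k).exists_isLowered hA hd (D.orthonormal.1 k)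
  exact ⟨⟨D, u, y, h⟩, rfl⟩

/-- Domination and Jensen's inequality bound exp(-t E_k) by a constant times the mean of exp(-t c n)
in `b_k`. Summing over `k` first leaves a product of geometric series over the occupation numbers.
-/
theorem LoweredData.summable_exp (hd : DominatesNumber A) (D : LoweredData A β) {t : ℝ}
    (ht : 0 < t) : Summable fun k => Real.exp (-t * D.E k) := by
  obtain ⟨c, hc, C, hC⟩ := hd
  have htc : 0 < t * c := mul_pos ht hc
  have h1 : Summable fun p : Occ s N × Occ s N =>
      Real.exp (-(t * c) * p.1.num) * ‖D.b p.2 p.1‖ ^ 2 := by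
    rw [summable_prod_of_nonneg fun _ => by positivity]
    have h2 := fun n => (HilbertBasis.hasSum_norm_apply_sq D.b n).mul_left
      (Real.exp (-(t * c) * n.num))
    refine ⟨fun n => (h2 n).summable, ?_⟩
    simp only [fun n => (h2 n).tsum_eq, mul_one]
    exact summable_exp_num htc
  have h3 := ((Equiv.prodComm _ _).summable_iff.2 h1).prod.mul_left (Real.exp (t * C))
  refine Summable.of_nonneg_of_le (fun _ => (Real.exp_pos _).le) (fun k => ?_) h3
  have h4 := (D.lowered k).exp_le (D.orthonormal.1 k) htc.le
  refine le_trans ?_ (mul_le_mul_of_nonneg_left h4 (Real.exp_pos _).le)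
  rw [← Real.exp_add, Real.exp_le_exp]
  have h5 := (D.lowered k).number_le (D.orthonormal.1 k) hC
  nlinarith

theorem EigenData.Z_pos (D : EigenData A β) : 0 < D.Z :=
  D.summable.tsum_pos (fun _ => (Real.exp_pos _).le) ⟨fun _ => 0, fun _ _ => Nat.zero_le 1⟩
    (Real.exp_pos _)

theorem EigenData.p_pos (D : EigenData A β) (k : Occ s N) : 0 < D.p k :=
  mul_pos (inv_pos.2 D.Z_pos) (Real.exp_pos _)

theorem EigenData.hasSum_p (D : EigenData A β) : HasSum D.p 1 := by
  have h := D.summable.hasSum.mul_left D.Z⁻¹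
  rwa [← EigenData.Z, inv_mul_cancel₀ D.Z_pos.ne'] at h

/-- The particle number of `b_k` is bounded by a multiple of E_k + C. Half of the Boltzmann exponent
pays for this factor, and the other half is summable by `LoweredData.summable_exp`. -/
theorem LoweredData.summable_number (hβ : 0 < β) (hd : DominatesNumber A) (D : LoweredData A β) :
    Summable fun k => D.p k * ∑ i, ‖D.y k i‖ ^ 2 := by
  have h1 := (D.summable_exp hd (half_pos hβ))
  obtain ⟨c, hc, C, hC⟩ := hd
  have h2 := h1.mul_left (D.Z⁻¹ * (c⁻¹ * (2 / β * Real.exp (β / 2 * C))))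
  refine Summable.of_nonneg_of_le (fun k => mul_nonneg (D.p_pos k).le (by positivity))
    (fun k => ?_) h2
  have h3 := (D.lowered k).number_le (D.orthonormal.1 k) hC
  rw [EigenData.p, mul_assoc, mul_assoc]
  refine mul_le_mul_of_nonneg_left ?_ (inv_pos.2 D.Z_pos).le
  have h4 : ∑ i, ‖D.y k i‖ ^ 2 ≤ c⁻¹ * (D.E k + C) := by
    rw [inv_mul_eq_div, le_div_iff₀ hc]
    linarith
  have h5 : D.E k + C ≤ 2 / β * Real.exp (β / 2 * (D.E k + C)) := by
    have h6 := Real.add_one_le_exp (β / 2 * (D.E k + C))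
    rw [div_mul_eq_mul_div, le_div_iff₀ hβ]
    linarith
  have h6 : Real.exp (-β * D.E k) * Real.exp (β / 2 * (D.E k + C)) =
      Real.exp (β / 2 * C) * Real.exp (-(β / 2) * D.E k) := by
    rw [← Real.exp_add, ← Real.exp_add]
    ring_nf
  calc Real.exp (-β * D.E k) * ∑ i, ‖D.y k i‖ ^ 2
      ≤ Real.exp (-β * D.E k) * (c⁻¹ * (2 / β * Real.exp (β / 2 * (D.E k + C)))) :=
        mul_le_mul_of_nonneg_left (h4.trans (mul_le_mul_of_nonneg_left h5 (inv_pos.2 hc).le))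
          (Real.exp_pos _).le
    _ = c⁻¹ * (2 / β) * (Real.exp (-β * D.E k) * Real.exp (β / 2 * (D.E k + C))) := by ring
    _ = _ := by rw [h6]; ring

/-! ### The one-body reduced density matrix in the eigenbasis -/

/-- The matrix elements of `a_i b` as a sum with at most one term. -/
theorem IsLowered.hasSum_apply {b : Fock s N} {E : ℝ} {u : ℕ → PreFock s N} {y : Fin N → Fock s N}
    (h : IsLowered A b E u y) (i : Fin N) (m : Occ s N) :
    HasSum (fun n => anni i (Finsupp.single n 1) m * b n) (y i m) ∧
    HasSum (fun n => ‖anni i (Finsupp.single n 1) m * b n‖) ‖y i m‖ := by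
  have h1 : ∀ n, anni i (Finsupp.single n 1) m = star (crea i (Finsupp.single m 1) n) := by
    intro n
    rw [anni_apply, toFock_single, one_smul, ← inner_conj_symm, inner_ket_toFock]
    rfl
  have h2 : y i m = ⟪toFock (crea i (Finsupp.single m 1)), b⟫_ℂ := by
    rw [← h.inner_eq, toFock_single, one_smul, inner_ket]
  simp only [h1, h2]
  by_cases hm : s = Statistics.fermion → m.1 i = 0
  · rw [crea_single_of _ _ _ hm]
    set m' := m.raise i hm
    set c : ℂ := 1 * (phase m i * (Real.sqrt (m.1 i + 1) : ℂ))
    have h3 : ⟪toFock (Finsupp.single m' c), b⟫_ℂ = star (Finsupp.single m' c m') * b m' := by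
      rw [toFock_single, inner_smul_left, inner_ket, Finsupp.single_eq_same]
      rfl
    rw [h3]
    constructor
    · refine hasSum_single m' fun n hn => ?_
      rw [Finsupp.single_eq_of_ne hn]
      simp
    · refine hasSum_single (f := fun n => ‖star (Finsupp.single m' c n) * b n‖) m' fun n hn => ?_
      rw [Finsupp.single_eq_of_ne hn]
      simp
  · rw [crea_single_of_not _ _ _ hm]
    simp [hasSum_zero]

theorem summable_norm_mul_norm (x y : Fock s N) : Summable fun m => ‖x m‖ * ‖y m‖ := by
  refine Summable.of_nonneg_of_le (fun _ => by positivity) (fun m => ?_)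
    ((hasSum_norm_sq x).summable.add (hasSum_norm_sq y).summable)
  nlinarith [sq_nonneg (‖x m‖ - ‖y m‖), sq_nonneg ‖x m‖, sq_nonneg ‖y m‖]

theorem tsum_norm_mul_norm_le (y : Fin N → Fock s N) (i j : Fin N) :
    ∑' m, ‖y j m‖ * ‖y i m‖ ≤ ∑ i, ‖y i‖ ^ 2 := by
  have h1 : ∀ i, ‖y i‖ ^ 2 ≤ ∑ i, ‖y i‖ ^ 2 := fun i =>
    Finset.single_le_sum (f := fun i => ‖y i‖ ^ 2) (fun _ _ => by positivity) (Finset.mem_univ i)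
  have h2 : ∑' m, ‖y j m‖ * ‖y i m‖ ≤ 1 / 2 * (‖y j‖ ^ 2 + ‖y i‖ ^ 2) := by
    refine hasSum_le (fun m => ?_) (summable_norm_mul_norm (y j) (y i)).hasSum
      (((hasSum_norm_sq (y j)).add (hasSum_norm_sq (y i))).mul_left (1 / 2))
    nlinarith [sq_nonneg (‖y j m‖ - ‖y i m‖)]
  linarith [h1 i, h1 j]

theorem LoweredData.summable_norm_mul_norm (hβ : 0 < β) (hd : DominatesNumber A)
    (D : LoweredData A β) (i j : Fin N) : Summable fun q : Occ s N × Occ s N =>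
      D.p q.1 * (‖D.y q.1 j q.2‖ * ‖D.y q.1 i q.2‖) := by
  have h0 : ∀ q : Occ s N × Occ s N, 0 ≤ D.p q.1 * (‖D.y q.1 j q.2‖ * ‖D.y q.1 i q.2‖) := fun q =>
    mul_nonneg (D.p_pos _).le (mul_nonneg (norm_nonneg _) (norm_nonneg _))
  have h1 : ∀ k, Summable fun m => D.p k * (‖D.y k j m‖ * ‖D.y k i m‖) := fun k =>
    (RDMFT.summable_norm_mul_norm (D.y k j) (D.y k i)).mul_left _
  have h2 : Summable fun k => ∑' m, D.p k * (‖D.y k j m‖ * ‖D.y k i m‖) := by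
    refine Summable.of_nonneg_of_le (fun k => tsum_nonneg fun m => h0 (k, m)) (fun k => ?_)
      (D.summable_number hβ hd)
    rw [tsum_mul_left]
    exact mul_le_mul_of_nonneg_left (tsum_norm_mul_norm_le (D.y k) i j) (D.p_pos _).le
  exact (summable_prod_of_nonneg h0).2 ⟨h1, h2⟩

theorem hasSum_of_forall_eq {ι : Type*} {f g : ι → ℂ} {a : ℂ} (h : HasSum f a)
    (hg : ∀ x, g x = f x) : HasSum g a := by
  rwa [funext hg]

/-- Both series are iterated sums of one triple series over eigenstates `k` and occupation states
`m`, `n`. It converges absolutely because the mean particle number is finite, so the order of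
summation is free. -/
theorem LoweredData.hasSum_rdmTerm (hβ : 0 < β) (hd : DominatesNumber A) (D : LoweredData A β)
    {ρ : Fock s N →L[ℂ] Fock s N}
    (hρ : ∀ x y, HasSum (fun k => (D.p k : ℂ) * (⟪y, D.b k⟫_ℂ * ⟪D.b k, x⟫_ℂ)) ⟪y, ρ x⟫_ℂ)
    (i j : Fin N) : ∃ S, HasSum (rdmTerm ρ i j) S ∧
      HasSum (fun k => (D.p k : ℂ) * ⟪D.y k j, D.y k i⟫_ℂ) S := by
  obtain ⟨g, hg⟩ : ∃ g : (Occ s N × Occ s N) × Occ s N → ℂ, ∀ k m n, g ((k, m), n) =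
      (D.p k : ℂ) * star (D.y k j m) * (anni i (Finsupp.single n 1) m * D.b k n) :=
    ⟨fun q => (D.p q.1.1 : ℂ) * star (D.y q.1.1 j q.1.2) *
      (anni i (Finsupp.single q.2 1) q.1.2 * D.b q.1.1 q.2), fun _ _ _ => rfl⟩
  have hn : ∀ (q : Occ s N × Occ s N), HasSum (fun n => g (q, n))
      ((D.p q.1 : ℂ) * star (D.y q.1 j q.2) * D.y q.1 i q.2) := by
    rintro ⟨k, m⟩
    simp only [hg]
    exact ((D.lowered k).hasSum_apply i m).1.mul_left _
  have hn' : ∀ (q : Occ s N × Occ s N), HasSum (fun n => ‖g (q, n)‖)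
      (D.p q.1 * (‖D.y q.1 j q.2‖ * ‖D.y q.1 i q.2‖)) := by
    rintro ⟨k, m⟩
    have h := ((D.lowered k).hasSum_apply i m).2.mul_left ‖(D.p k : ℂ) * star (D.y k j m)‖
    have h1 : ‖(D.p k : ℂ) * star (D.y k j m)‖ * ‖D.y k i m‖ =
        D.p k * (‖D.y k j m‖ * ‖D.y k i m‖) := by
      rw [norm_mul, norm_star, Complex.norm_real, Real.norm_of_nonneg (D.p_pos _).le, mul_assoc]
    rw [h1] at h
    simp only [hg, fun n => norm_mul ((D.p k : ℂ) * star (D.y k j m))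
      (anni i (Finsupp.single n 1) m * D.b k n)]
    exact h
  have hsum : Summable g := by
    refine Summable.of_norm ?_
    rw [summable_prod_of_nonneg fun _ => norm_nonneg _]
    refine ⟨fun q => (hn' q).summable, ?_⟩
    simp only [fun q => (hn' q).tsum_eq]
    exact D.summable_norm_mul_norm hβ hd i j
  refine ⟨∑' q, g q, ?_, ?_⟩
  · have h1 := (Equiv.prodComm _ _).hasSum_iff.2 hsum.hasSum
    have h2 := (Equiv.prodComm _ _).summable_iff.2 hsum
    refine h1.prod_fiberwise fun n => ?_
    have h3 : Summable fun q : Occ s N × Occ s N => g (q, n) := h2.prod_factor n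
    have h4 := h3.hasSum.prod_fiberwise (g := fun k => (D.p k : ℂ) *
      (⟪ket n, D.b k⟫_ℂ * ⟪D.b k, toFock ((crea j * anni i : PreOp s N) (Finsupp.single n 1))⟫_ℂ))
      fun k => ?_
    · have h5 := h4.unique (hρ _ _)
      rw [rdmTerm, ← h5]
      exact h3.hasSum
    · have h5 : ⟪D.b k, toFock ((crea j * anni i : PreOp s N) (Finsupp.single n 1))⟫_ℂ =
          ⟪D.y k j, toFock (anni i (Finsupp.single n 1))⟫_ℂ := by
        rw [← inner_conj_symm, Module.End.mul_apply, ← (D.lowered k).inner_eq, inner_conj_symm]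
      have h6 := (lp.hasSum_inner (𝕜 := ℂ) (D.y k j) (toFock (anni i (Finsupp.single n 1)))).mul_left
        ((D.p k : ℂ) * D.b k n)
      rw [h5, inner_ket, ← mul_assoc]
      refine hasSum_of_forall_eq h6 fun m => ?_
      simp only [hg, toFock_apply]
      change _ = (D.p k : ℂ) * D.b k n * (anni i (Finsupp.single n 1) m * star (D.y k j m))
      ring
  · refine (hsum.hasSum.prod_fiberwise hn).prod_fiberwise fun k => ?_
    have h1 := (lp.hasSum_inner (𝕜 := ℂ) (D.y k j) (D.y k i)).mul_left (D.p k : ℂ)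
    refine hasSum_of_forall_eq h1 fun m => ?_
    change _ = (D.p k : ℂ) * (D.y k i m * star (D.y k j m))
    ring

end LoweredData

/-! ### The Gibbs variational principle -/

/-- Bessel's inequality in the form of `A'`, carried to the limit along approximants of `b_k`. Their
energies converge, since the potential is a form in the convergent vectors `anni i (u k n)`. -/
theorem LoweredData.sum_le_of_potential {A A' : PreOp s N} {β : ℝ} (D : LoweredData A β)
    (D' : EigenData A' β) {w : Matrix (Fin N) (Fin N) ℂ} (hA' : A' = A + potential w) {C : ℝ}
    (hB : IsNonnegOp (A' + (C : ℂ) • 1)) (k : Occ s N) (F : Finset (Occ s N)) :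
    ∑ l ∈ F, (D'.E l + C) * ‖⟪D'.b l, D.b k⟫_ℂ‖ ^ 2 ≤
      D.E k + (∑ i, ∑ j, w i j * ⟪D.y k i, D.y k j⟫_ℂ).re + C := by
  choose u hu using fun l => (D'.maps l).exists_isApprox C
  have h := D.lowered k
  have h1 : Tendsto (fun n => ∑ l ∈ F, (D'.E l + C) * ‖⟪D'.b l, toFock (D.u k n)⟫_ℂ‖ ^ 2) atTop
      (𝓝 (∑ l ∈ F, (D'.E l + C) * ‖⟪D'.b l, D.b k⟫_ℂ‖ ^ 2)) :=
    tendsto_finsetSum _ fun l _ => ((tendsto_const_nhds.inner h.tendsto).norm.pow 2).const_mul _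
  have h2 : Tendsto (fun n => expect (potential w) (D.u k n)) atTop
      (𝓝 (∑ i, ∑ j, w i j * ⟪D.y k i, D.y k j⟫_ℂ).re) := by
    simp only [expect, inner_potential]
    refine (Complex.continuous_re.tendsto _).comp ?_
    exact tendsto_finsetSum _ fun i _ => tendsto_finsetSum _ fun j _ =>
      ((h.tendsto_anni i).inner (h.tendsto_anni j)).const_mul _
  have h3 := (h.tendsto_expect.add h2).add ((h.tendsto.norm.pow 2).const_mul C)
  rw [D.orthonormal.1 k, one_pow, mul_one] at h3
  refine le_of_tendsto_of_tendsto' h1 h3 fun n => ?_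
  refine (sum_eigenvalue_le_expect hB D'.orthonormal hu F (D.u k n)).trans_eq ?_
  rw [expect_shift, hA', expect_add]

theorem hasSum_weighted_rows {ι : Type*} {W : ι → ι → ℝ} (hW : ∀ k l, 0 ≤ W k l)
    (hcol : ∀ l, HasSum (fun k => W k l) 1) {p : ι → ℝ} (hp0 : ∀ l, 0 ≤ p l) (hp : HasSum p 1) :
    (∀ k, Summable fun l => W k l * p l) ∧ HasSum (fun k => ∑' l, W k l * p l) 1 := by
  obtain ⟨g, hg⟩ : ∃ g : ι × ι → ℝ, ∀ l k, g (l, k) = W k l * p l :=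
    ⟨fun q => W q.2 q.1 * p q.1, fun _ _ => rfl⟩
  have h1 : ∀ l, HasSum (fun k => g (l, k)) (p l) := fun l => by
    simp only [hg]
    simpa using (hcol l).mul_right (p l)
  have h2 : Summable g := by
    refine (summable_prod_of_nonneg fun q => ?_).2 ⟨fun l => (h1 l).summable, ?_⟩
    · obtain ⟨l, k⟩ := q
      rw [hg]
      exact mul_nonneg (hW k l) (hp0 l)
    · simp only [fun l => (h1 l).tsum_eq]
      exact hp.summable
  have h3 : ∑' q, g q = 1 := (h2.hasSum.prod_fiberwise h1).unique hp
  have h4 : Summable fun q : ι × ι => g q.swap := (Equiv.prodComm ι ι).summable_iff.2 h2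
  have h5 : HasSum (fun q : ι × ι => g q.swap) 1 := by
    rw [← h3]
    exact (Equiv.prodComm ι ι).hasSum_iff.2 h2.hasSum
  have h6 : ∀ k, Summable fun l => W k l * p l := fun k => by
    simpa only [Prod.swap_prod_mk, hg] using h4.prod_factor k
  refine ⟨h6, h5.prod_fiberwise fun k => ?_⟩
  simpa only [Prod.swap_prod_mk, hg] using (h6 k).hasSum

/-- Klein's inequality, for the eigenvalues of two Gibbs states and the overlaps `W` of their
eigenbases. -/
theorem klein_inequality {ι : Type*} {W : ι → ι → ℝ} (hW : ∀ k l, 0 ≤ W k l)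
    (hrow : ∀ k, HasSum (W k) 1) (hcol : ∀ l, HasSum (fun k => W k l) 1)
    {E E' Δ p p' : ι → ℝ} {β a a' C R : ℝ} (hβ : 0 < β)
    (hp : ∀ k, p k = Real.exp (-(β * E k + a))) (hp' : ∀ k, p' k = Real.exp (-(β * E' k + a')))
    (hp1 : HasSum p 1) (hp1' : HasSum p' 1) (hC : ∀ l, 0 ≤ E' l + C)
    (hvar : ∀ k (F : Finset ι), ∑ l ∈ F, (E' l + C) * W k l ≤ E k + Δ k + C)
    (hR : HasSum (fun k => p k * Δ k) R) (k l : ι) :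
    W k l * (p k * (β * E' l + a' - (β * E k + a) - 1) + p' l) ≤ β * R + a' - a := by
  -- With x = log p_k - log p'_l, this is p'_l = p_k e^{-x} together with e^{-x} ≥ 1 - x.
  have hpos : ∀ k l, 0 ≤ W k l * (p k * (β * E' l + a' - (β * E k + a) - 1) + p' l) := by
    intro k l
    refine mul_nonneg (hW k l) ?_
    have h1 := Real.add_one_le_exp (-(β * E' l + a' - (β * E k + a)))
    have h2 : p' l = p k * Real.exp (-(β * E' l + a' - (β * E k + a))) := by
      rw [hp, hp', ← Real.exp_add]
      ring_nf
    have h3 : 0 < p k := by rw [hp]; exact Real.exp_pos _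
    rw [h2]
    nlinarith
  have hnn : ∀ k l, 0 ≤ (E' l + C) * W k l := fun k l => mul_nonneg (hC l) (hW k l)
  have hQ : ∀ k, Summable fun l => (E' l + C) * W k l := fun k =>
    summable_of_sum_le (hnn k) (hvar k)
  have hQle : ∀ k, ∑' l, (E' l + C) * W k l ≤ E k + Δ k + C := fun k =>
    (hQ k).tsum_le_of_sum_le (hvar k)
  have hp0' : ∀ l, 0 ≤ p' l := fun l => by rw [hp']; exact (Real.exp_pos _).le
  obtain ⟨hsum', hr⟩ := hasSum_weighted_rows hW hcol hp0' hp1'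
  have hS : ∀ k, HasSum (fun l => W k l * (p k * (β * E' l + a' - (β * E k + a) - 1) + p' l))
      (p k * (β * ∑' l, (E' l + C) * W k l) + p k * (a' - β * C - (β * E k + a) - 1) +
        ∑' l, W k l * p' l) := by
    intro k
    have h1 := ((((hQ k).hasSum.mul_left β).mul_left (p k)).add
      ((hrow k).mul_left (p k * (a' - β * C - (β * E k + a) - 1)))).add (hsum' k).hasSum
    rw [mul_one] at h1
    have h2 : (fun l => W k l * (p k * (β * E' l + a' - (β * E k + a) - 1) + p' l)) = fun l =>
        p k * (β * ((E' l + C) * W k l)) + p k * (a' - β * C - (β * E k + a) - 1) * W k l +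
          W k l * p' l := by
      funext l
      ring
    rw [h2]
    exact h1
  -- The terms p_k E_k cancel, so their summability is not needed.
  have hle : ∀ k, p k * (β * ∑' l, (E' l + C) * W k l) +
      p k * (a' - β * C - (β * E k + a) - 1) + ∑' l, W k l * p' l ≤
      β * (p k * Δ k) + p k * (a' - a - 1) + ∑' l, W k l * p' l := by
    intro k
    have h3 : 0 < p k := by rw [hp]; exact Real.exp_pos _
    have h4 := mul_le_mul_of_nonneg_left (mul_le_mul_of_nonneg_left (hQle k) hβ.le) h3.le
    linarith
  have hT := ((hR.mul_left β).add (hp1.mul_right (a' - a - 1))).add hr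
  have h1 := le_hasSum (hS k) l fun l _ => hpos k l
  have h2 := le_hasSum hT k fun k _ => ((hS k).nonneg (hpos k)).trans (hle k)
  linarith [hle k]

theorem eq_of_klein_eq {x a b : ℝ} (ha : 0 < a) (hb : b = a * Real.exp (-x))
    (h : a * (x - 1) + b ≤ 0) : x = 0 := by
  by_contra hx
  have := Real.add_one_lt_exp (neg_ne_zero.2 hx)
  rw [hb] at h
  nlinarith

theorem EigenData.p_eq {A : PreOp s N} {β : ℝ} (D : EigenData A β) (k : Occ s N) :
    D.p k = Real.exp (-(β * D.E k + Real.log D.Z)) := by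
  rw [neg_add, Real.exp_add, Real.exp_neg (Real.log _), Real.exp_log D.Z_pos, EigenData.p]
  ring_nf

theorem LoweredData.klein {A A' : PreOp s N} {β : ℝ} (hβ : 0 < β) (D : LoweredData A β)
    (D' : EigenData A' β) (hA' : IsHermitianOp A') {w : Matrix (Fin N) (Fin N) ℂ}
    (h : A' = A + potential w) {R : ℝ}
    (hR : HasSum (fun k => D.p k * (∑ i, ∑ j, w i j * ⟪D.y k i, D.y k j⟫_ℂ).re) R)
    (k l : Occ s N) :
    ‖⟪D'.b l, D.b k⟫_ℂ‖ ^ 2 * (D.p k * (β * D'.E l + Real.log D'.Z -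
      (β * D.E k + Real.log D.Z) - 1) + D'.p l) ≤ β * R + Real.log D'.Z - Real.log D.Z := by
  obtain ⟨C, hB⟩ := D'.bounded_below.exists_nonneg hA'
  refine klein_inequality (W := fun k l => ‖⟪D'.b l, D.b k⟫_ℂ‖ ^ 2) (fun _ _ => by positivity)
    (fun k => ?_) (fun l => ?_) hβ D.p_eq D'.p_eq D.hasSum_p D'.hasSum_p (C := C) (fun l => ?_)
    (D.sum_le_of_potential D' h hB) hR k l
  · have h1 := HilbertBasis.hasSum_norm_inner_sq D'.b (D.b k)
    rwa [D.orthonormal.1 k, one_pow] at h1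
  · have h1 := HilbertBasis.hasSum_norm_inner_sq D.b (D'.b l)
    rw [D'.orthonormal.1 l, one_pow] at h1
    simpa only [norm_inner_symm] using h1
  · obtain ⟨u, hu⟩ := (D'.maps l).exists_isApprox C
    exact hu.eigenvalue_nonneg hB (D'.orthonormal.1 l)

/-! ### Uniqueness of the potential -/

/-- Expanding ⟨A u, b_k⟩ = E_k ⟨u, b_k⟩ in the other eigenbasis, only overlapping pairs contribute,
and for these E_k may be replaced by E'_l + κ. -/
theorem EigenData.op_eq_add {A A' : PreOp s N} {β β' : ℝ} (D : EigenData A β) (D' : EigenData A' β')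
    {κ : ℝ} (h : ∀ k l, ⟪D'.b l, D.b k⟫_ℂ ≠ 0 → D.E k = D'.E l + κ) (u : PreFock s N) :
    A u = A' u + (κ : ℂ) • u := by
  apply toFock_injective
  have he : ∀ k, ⟪toFock (A u), D.b k⟫_ℂ = D.E k * ⟪toFock u, D.b k⟫_ℂ := fun k => by
    rw [← (D.maps k).2, inner_smul_right]
  have he' : ∀ l, ⟪toFock (A' u), D'.b l⟫_ℂ = D'.E l * ⟪toFock u, D'.b l⟫_ℂ := fun l => by
    rw [← (D'.maps l).2, inner_smul_right]
  have h1 : ∀ k, ⟪toFock (A u), D.b k⟫_ℂ = ⟪toFock (A' u + (κ : ℂ) • u), D.b k⟫_ℂ := by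
    intro k
    have h2 := (D'.b.hasSum_inner_mul_inner (toFock u) (D.b k)).mul_left (D.E k : ℂ)
    have h3 := D'.b.hasSum_inner_mul_inner (toFock (A' u + (κ : ℂ) • u)) (D.b k)
    have h4 : ∀ l, (D.E k : ℂ) * (⟪toFock u, D'.b l⟫_ℂ * ⟪D'.b l, D.b k⟫_ℂ) =
        ⟪toFock (A' u + (κ : ℂ) • u), D'.b l⟫_ℂ * ⟪D'.b l, D.b k⟫_ℂ := by
      intro l
      by_cases h0 : ⟪D'.b l, D.b k⟫_ℂ = 0
      · rw [h0]; ring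
      · rw [map_add, map_smul, inner_add_left, inner_smul_left, he', h k l h0, Complex.conj_ofReal]
        push_cast
        ring
    simp only [h4] at h2
    rw [he]
    exact h2.unique h3
  apply D.b.repr.injective
  refine lp.ext (funext fun k => ?_)
  rw [D.b.repr_apply_apply, D.b.repr_apply_apply, ← inner_conj_symm, h1, inner_conj_symm]

/-! ### Recovering the potential from the vacuum and the one-particle states -/

/-- The vacuum. -/
def vacuum : Occ s N := ⟨0, fun _ _ => Nat.zero_le 1⟩

/-- The occupation numbers of one particle in the state `i`. -/
def oneParticle (i : Fin N) : Occ s N :=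
  ⟨Pi.single i 1, fun _ j => by
    by_cases h : j = i
    · subst h; simp
    · simp [h]⟩

theorem anni_vacuum (i : Fin N) : anni i (Finsupp.single (vacuum : Occ s N) (1 : ℂ)) = 0 := by
  simp [anni_single, vacuum]

theorem anni_oneParticle (a i : Fin N) : anni a (Finsupp.single (oneParticle i : Occ s N) (1 : ℂ)) =
    if a = i then Finsupp.single vacuum 1 else 0 := by
  rw [anni_single]
  split_ifs with h
  · subst h
    have h1 : (oneParticle a : Occ s N).lower a = vacuum := by
      apply Subtype.ext
      funext j
      by_cases hj : j = a
      · subst hj; simp [Occ.lower, oneParticle, vacuum]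
      · simp [Occ.lower, oneParticle, vacuum, hj]
    have h2 : phase (oneParticle a : Occ s N) a = 1 := by
      unfold phase
      rw [Finset.sum_eq_zero, pow_zero]
      intro j hj
      have : j ≠ a := (Finset.mem_Ioi.1 hj).ne'
      simp [oneParticle, this]
    rw [h1, h2]
    simp [oneParticle]
  · simp [oneParticle, h]

/-- The potential annihilates the vacuum, which forces κ = 0. Its matrix elements between
one-particle states are the entries of `w`. -/
theorem eq_zero_of_potential_eq_const {w : Matrix (Fin N) (Fin N) ℂ} {κ : ℂ}
    (h : ∀ u : PreFock s N, potential w u = κ • u) : w = 0 := by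
  have hκ : κ = 0 := by
    have h1 := h (Finsupp.single vacuum 1)
    simp only [potential, LinearMap.sum_apply, LinearMap.smul_apply, Module.End.mul_apply,
      anni_vacuum, map_zero, smul_zero, Finset.sum_const_zero] at h1
    simpa using h1.symm
  ext i j
  have h1 := inner_potential w (Finsupp.single (oneParticle i : Occ s N) (1 : ℂ))
    (Finsupp.single (oneParticle j) 1)
  rw [h, hκ, zero_smul, map_zero, inner_zero_right, Finset.sum_eq_single i,
    Finset.sum_eq_single j] at h1
  · rw [anni_oneParticle, anni_oneParticle, if_pos rfl, if_pos rfl, inner_toFock] at h1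
    simpa [toFock_apply] using h1.symm
  · intro b _ hb
    rw [anni_oneParticle b j, if_neg hb]
    simp
  · simp
  · intro a _ ha
    rw [anni_oneParticle a i, if_neg ha]
    simp
  · simp

theorem potential_add (v w : Matrix (Fin N) (Fin N) ℂ) :
    (potential (v + w) : PreOp s N) = potential v + potential w := by
  refine LinearMap.ext fun u => ?_
  simp only [potential, LinearMap.add_apply, LinearMap.sum_apply, LinearMap.smul_apply,
    Matrix.add_apply, add_smul, Finset.sum_add_distrib]

theorem Hamiltonian.withPot_eq_add (H : Hamiltonian s N) (v v' : Matrix (Fin N) (Fin N) ℂ) :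
    H.withPot v' = H.withPot v + potential (v' - v) := by
  rw [Hamiltonian.withPot, Hamiltonian.withPot, add_assoc, ← potential_add, add_sub_cancel]

theorem Hamiltonian.exists_loweredData (H : Hamiltonian s N) {β : ℝ} (hβ : 0 < β)
    {v : Matrix (Fin N) (Fin N) ℂ} (hv : v ∈ H.admissible β) :
    ∃ D : LoweredData (H.withPot v) β, ∀ i j, Summable (rdmTerm (H.gibbsState β v) i j) ∧
      HasSum (fun k => (D.p k : ℂ) * ⟪D.y k j, D.y k i⟫_ℂ) (rdm (H.gibbsState β v) i j) := by
  obtain ⟨D, hD⟩ := exists_eigenData hv.2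
  have hd := H.dominatesNumber hβ hv.1 D
  obtain ⟨L, rfl⟩ := D.exists_loweredData (H.withPot_hermitian hv.1) hd
  refine ⟨L, fun i j => ?_⟩
  obtain ⟨S, h1, h2⟩ := L.hasSum_rdmTerm hβ hd hD i j
  refine ⟨h1.summable, ?_⟩
  have h3 : rdm (H.gibbsState β v) i j = S := h1.tsum_eq
  rwa [h3]

theorem LoweredData.hasSum_potential {A : PreOp s N} {β : ℝ} (D : LoweredData A β)
    {γ : Matrix (Fin N) (Fin N) ℂ}
    (h : ∀ i j, HasSum (fun k => (D.p k : ℂ) * ⟪D.y k j, D.y k i⟫_ℂ) (γ i j))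
    (w : Matrix (Fin N) (Fin N) ℂ) :
    HasSum (fun k => D.p k * (∑ i, ∑ j, w i j * ⟪D.y k i, D.y k j⟫_ℂ).re)
      (∑ i, ∑ j, w i j * γ j i).re := by
  have h1 : HasSum (fun k => ∑ i, ∑ j, w i j * ((D.p k : ℂ) * ⟪D.y k i, D.y k j⟫_ℂ))
      (∑ i, ∑ j, w i j * γ j i) :=
    hasSum_sum fun i _ => hasSum_sum fun j _ => (h j i).mul_left (w i j)
  have h2 := Complex.hasSum_re h1
  have h3 : ∀ k, (∑ i, ∑ j, w i j * ((D.p k : ℂ) * ⟪D.y k i, D.y k j⟫_ℂ)).re =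
      D.p k * (∑ i, ∑ j, w i j * ⟪D.y k i, D.y k j⟫_ℂ).re := by
    intro k
    rw [← Complex.re_ofReal_mul, Finset.mul_sum]
    congr 1
    refine Finset.sum_congr rfl fun i _ => ?_
    rw [Finset.mul_sum]
    exact Finset.sum_congr rfl fun j _ => by ring
  simpa only [h3] using h2

theorem Hamiltonian.rdm_injOn (H : Hamiltonian s N) {β : ℝ} (hβ : 0 < β) :
    Set.InjOn (fun v => rdm (H.gibbsState β v)) (H.admissible β) := by
  intro v hv v' hv' hγ
  obtain ⟨D, hD⟩ := H.exists_loweredData hβ hv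
  obtain ⟨D', hD'⟩ := H.exists_loweredData hβ hv'
  have hγ : rdm (H.gibbsState β v) = rdm (H.gibbsState β v') := hγ
  have hR := D.hasSum_potential (fun i j => (hD i j).2) (v' - v)
  have hR' := D'.hasSum_potential (fun i j => (hD' i j).2) (v - v')
  -- Equality of the 1RDMs enters here: the two Klein bounds become negatives of each other.
  have hneg : (∑ i, ∑ j, (v - v') i j * rdm (H.gibbsState β v') j i).re =
      -(∑ i, ∑ j, (v' - v) i j * rdm (H.gibbsState β v) j i).re := by
    rw [← Complex.neg_re, hγ]
    congr 1
    simp only [← Finset.sum_neg_distrib, Matrix.sub_apply]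
    exact Finset.sum_congr rfl fun i _ => Finset.sum_congr rfl fun j _ => by ring
  rw [hneg] at hR'
  have k1 := D.klein hβ D'.toEigenData (H.withPot_hermitian hv'.1) (H.withPot_eq_add v v') hR
  have k2 := D'.klein hβ D.toEigenData (H.withPot_hermitian hv.1) (H.withPot_eq_add v' v) hR'
  have hφ : ∀ (a x b : ℝ), 0 < a → b = a * Real.exp (-x) → 0 ≤ a * (x - 1) + b := by
    rintro a x b ha rfl
    nlinarith [Real.add_one_le_exp (-x)]
  have hp : ∀ k l, D'.p l = D.p k * Real.exp (-(β * D'.E l + Real.log D'.Z -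
      (β * D.E k + Real.log D.Z))) := fun k l => by
    rw [D.p_eq, D'.p_eq, ← Real.exp_add]; ring_nf
  have hp' : ∀ k l, D.p l = D'.p k * Real.exp (-(β * D.E l + Real.log D.Z -
      (β * D'.E k + Real.log D'.Z))) := fun k l => by
    rw [D.p_eq, D'.p_eq, ← Real.exp_add]; ring_nf
  -- The exchanged bound is nonnegative, hence the first one is nonpositive; the index `vacuum` is
  -- an arbitrary choice.
  have hle := (mul_nonneg (sq_nonneg ‖⟪D.b vacuum, D'.b vacuum⟫_ℂ‖)
    (hφ _ _ _ (D'.p_pos vacuum) (hp' vacuum vacuum))).trans (k2 vacuum vacuum)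
  have hE : ∀ k l, ⟪D'.b l, D.b k⟫_ℂ ≠ 0 →
      D.E k = D'.E l + (Real.log D'.Z - Real.log D.Z) / β := by
    intro k l h0
    have h1 : 0 < ‖⟪D'.b l, D.b k⟫_ℂ‖ ^ 2 := by positivity
    have h2 := k1 k l
    have h3 : D.p k * (β * D'.E l + Real.log D'.Z - (β * D.E k + Real.log D.Z) - 1) + D'.p l ≤ 0 := by
      by_contra! h4
      have := mul_pos h1 h4
      linarith
    have h4 := eq_of_klein_eq (D.p_pos k) (hp k l) h3
    field_simp
    linarith
  have hop := D.op_eq_add D'.toEigenData hE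
  refine sub_eq_zero.1 (eq_zero_of_potential_eq_const (s := s)
    (κ := (((Real.log D'.Z - Real.log D.Z) / β : ℝ) : ℂ)) fun u => ?_)
  have h1 := congrArg (fun B : PreOp s N => B u) (H.withPot_eq_add v' v)
  exact add_left_cancel (h1.symm.trans (hop u))

end RDMFT

end

theorem theorem3p9 (s : RDMFT.Statistics) (N : ℕ) (H : RDMFT.Hamiltonian s N) (β : ℝ) (hβ : 0 < β) :
    (∀ v ∈ H.admissible β, ∀ i j : Fin N, Summable (RDMFT.rdmTerm (H.gibbsState β v) i j)) ∧
    Set.InjOn (fun v => RDMFT.rdm (H.gibbsState β v)) (H.admissible β) := by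
  refine ⟨fun v hv i j => ?_, H.rdm_injOn hβ⟩
  obtain ⟨_, h⟩ := H.exists_loweredData hβ hv
  exact (h i j).1
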